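/- Let $\varepsilon > 0$ be fixed. There are arbitrarily large finite sets $S$ of prime numbers such that, with $s := \#S$, $$\#\{(a,c) \in \mathbb{Z}^2 : a + 1 = c, \text{ and every prime } p \text{ dividing } ac \text{ lies in } S\} \;\geq\; e^{s^{1/6-\varepsilon}}.$$ That is, for every $N$ there is such a set $S$ with $s \geq N$. -/

import Mathlib

/-- The integer solutions `(a, c)` of `a + 1 = c` such that every prime dividing `a * c` lies
in `S`. (Every prime divides `0`, so for finite `S` neither `a` nor `c` can vanish.) -/
def sUnitSolutions (S : Finset ℕ) : Set (ℤ × ℤ) :=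
  {x | x.1 + 1 = x.2 ∧ ∀ p : ℕ, p.Prime → (p : ℤ) ∣ x.1 * x.2 → p ∈ S}

/-! Fix a large `T`, put m = T^a with a ≥ 1/ε and y = T^(6a+18), and take disjoint sets `P₁`, `P₂`
of primes of size nearly y. Let u run over products of 2m primes of `P₁`, v over products of m
primes of `P₂`, and x over 1 ≤ x ≤ X = y^(m/2). If ux ≡ 1 mod v, then ux = vz + 1 with z ≤ Z, where
Z is about y^m X. Once there are T^m times more triples (u, v, x) than pairs (x, z), some fixed (x,
z) serves T^m pairs (u, v), each giving a solution (vz, ux). Every prime involved is at most y or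
divides xz, and xz has few prime factors, so s ≤ T^(6a+19), while the number of solutions is T^m ≥
e^m with m = T^a.

It must be shown that ux ≡ 1 mod v has about X/v times the expected number of solutions, on average
over v, although X is far below v (`abs_sum_mul_card_inversePairs_sub_le`). Additive characters
detect the congruence, and the fractions h/v are sorted by reduced denominator q. Here q = 1 is the
main term. For the products q of j ≥ 1 primes, Cauchy-Schwarz separates x from the inverse of u. The
x-sum is handled by Parseval. In the mean square over reduced h, inverses of u may be replaced by u
itself (`sum_norm_sq_inverse`), after which `large_sieve_fractions` applies; u has size up to y^(2m)
to match the square of the largest q.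

The exponent 1/6 arises as follows. Choosing r primes rather than r integers up to y loses about
r^r, so u and v together lose about m^(3m). The error terms then force X to be at least about
m^(3m), and the pigeonhole forces y^m ≥ m^(3m) X, that is, y at least about m^6. The remaining
powers of `T` absorb logarithms and constants. -/

open Finset

/-! ### Additive characters -/

/-- The additive character `x ↦ exp (2πix)` of `ℝ`. -/
noncomputable def unitExp (x : ℝ) : ℂ := Complex.exp (2 * Real.pi * x * Complex.I)

lemma unitExp_add (x y : ℝ) : unitExp (x + y) = unitExp x * unitExp y := by
  simp only [unitExp, ← Complex.exp_add]
  congr 1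
  push_cast
  ring

lemma unitExp_zero : unitExp 0 = 1 := by simp [unitExp]

lemma unitExp_natMul (n : ℕ) (x : ℝ) : unitExp (n * x) = unitExp x ^ n := by
  simp only [unitExp, ← Complex.exp_nat_mul]
  congr 1
  push_cast
  ring

lemma norm_unitExp (x : ℝ) : ‖unitExp x‖ = 1 := by
  have : (2 * Real.pi * x * Complex.I : ℂ) = ((2 * Real.pi * x : ℝ) : ℂ) * Complex.I := by
    push_cast; ring
  rw [unitExp, this, Complex.norm_exp_ofReal_mul_I]

lemma unitExp_eq_one_iff (x : ℝ) : unitExp x = 1 ↔ ∃ n : ℤ, x = n := by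
  rw [unitExp, Complex.exp_eq_one_iff]
  have h2 : (2 * Real.pi * Complex.I : ℂ) ≠ 0 := Complex.two_pi_I_ne_zero
  constructor
  · rintro ⟨n, hn⟩
    refine ⟨n, ?_⟩
    have : (x : ℂ) = n := mul_right_cancel₀ h2 (by rw [← hn]; ring)
    exact_mod_cast this
  · rintro ⟨n, rfl⟩
    exact ⟨n, by push_cast; ring⟩

lemma unitExp_int (n : ℤ) : unitExp n = 1 := (unitExp_eq_one_iff _).2 ⟨n, rfl⟩

lemma conj_unitExp (x : ℝ) : (starRingEnd ℂ) (unitExp x) = unitExp (-x) := by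
  rw [unitExp, unitExp, ← Complex.exp_conj]
  congr 1
  simp [Complex.conj_ofNat]

lemma unitExp_div_congr {q : ℕ} (hq : q ≠ 0) {a b : ℤ} (h : a ≡ b [ZMOD q]) :
    unitExp ((a : ℝ) / q) = unitExp ((b : ℝ) / q) := by
  obtain ⟨c, hc⟩ := h.dvd
  have hb : b = a + q * c := by linarith
  have hq' : (q : ℝ) ≠ 0 := by exact_mod_cast hq
  have : (b : ℝ) / q = a / q + c := by
    rw [hb]; push_cast; field_simp
  rw [this, unitExp_add, unitExp_int, mul_one]

lemma sum_range_unitExp {v : ℕ} (hv : v ≠ 0) (n : ℤ) :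
    ∑ h ∈ range v, unitExp ((h : ℝ) / v * n) = if (v : ℤ) ∣ n then (v : ℂ) else 0 := by
  have hv' : (v : ℝ) ≠ 0 := by exact_mod_cast hv
  have key : ∀ h : ℕ, unitExp ((h : ℝ) / v * n) = unitExp ((n : ℝ) / v) ^ h := by
    intro h
    rw [← unitExp_natMul]
    congr 1
    ring
  simp only [key]
  split_ifs with hd
  · obtain ⟨c, rfl⟩ := hd
    have : unitExp (((v * c : ℤ) : ℝ) / v) = 1 := by
      rw [unitExp_eq_one_iff]
      exact ⟨c, by push_cast; field_simp⟩
    simp only [this, one_pow, sum_const, card_range, nsmul_eq_mul, mul_one]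
  · have h1 : unitExp ((n : ℝ) / v) ≠ 1 := by
      rw [Ne, unitExp_eq_one_iff]
      rintro ⟨c, hc⟩
      apply hd
      refine ⟨c, ?_⟩
      rw [div_eq_iff hv'] at hc
      have : n = c * v := by exact_mod_cast hc
      rw [this, mul_comm]
    rw [geom_sum_eq h1, ← unitExp_natMul, mul_div_cancel₀ _ hv', unitExp_int]
    simp

/-! ### Fractions sorted by reduced denominator -/

/-- The reduced residues modulo `q`. -/
def reducedResidues (q : ℕ) : Finset ℕ := {h ∈ range q | q.Coprime h}

lemma mem_reducedResidues {q h : ℕ} : h ∈ reducedResidues q ↔ h < q ∧ q.Coprime h := by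
  simp [reducedResidues]

/-- Each h / v is put in lowest terms by cancelling gcd(v, h). -/
lemma sum_range_div_eq_sum_divisors {M : Type*} [AddCommMonoid M] (f : ℝ → M) {v : ℕ}
    (hv : v ≠ 0) :
    ∑ h ∈ range v, f ((h : ℝ) / v) =
      ∑ q ∈ v.divisors, ∑ h ∈ reducedResidues q, f ((h : ℝ) / q) := by
  rw [Finset.sum_sigma']
  refine Finset.sum_nbij' (fun h => ⟨v / v.gcd h, h / v.gcd h⟩) (fun x => x.2 * (v / x.1))
    ?_ ?_ ?_ ?_ ?_
  · intro h hh
    have hg : 0 < v.gcd h := Nat.gcd_pos_of_pos_left _ (Nat.pos_of_ne_zero hv)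
    simp only [mem_sigma, Nat.mem_divisors, mem_reducedResidues]
    refine ⟨⟨Nat.div_dvd_of_dvd (Nat.gcd_dvd_left _ _), hv⟩, ?_, Nat.coprime_div_gcd_div_gcd hg⟩
    exact Nat.div_lt_div_of_lt_of_dvd (Nat.gcd_dvd_left _ _) (mem_range.1 hh)
  · rintro ⟨q, h⟩ hx
    simp only [mem_sigma, Nat.mem_divisors, mem_reducedResidues] at hx
    obtain ⟨⟨⟨d, rfl⟩, -⟩, hlt, -⟩ := hx
    have hq : 0 < q := by omega
    have hd : 0 < d := Nat.pos_of_ne_zero (right_ne_zero_of_mul hv)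
    simp only [mem_range, Nat.mul_div_cancel_left d hq]
    exact Nat.mul_lt_mul_of_pos_right hlt hd
  · intro h hh
    have hg : 0 < v.gcd h := Nat.gcd_pos_of_pos_left _ (Nat.pos_of_ne_zero hv)
    simp only
    rw [Nat.div_div_self (Nat.gcd_dvd_left _ _) hv, Nat.div_mul_cancel (Nat.gcd_dvd_right _ _)]
  · rintro ⟨q, h⟩ hx
    simp only [mem_sigma, Nat.mem_divisors, mem_reducedResidues] at hx
    obtain ⟨⟨⟨d, rfl⟩, -⟩, hlt, hco⟩ := hx
    have hq : 0 < q := by omega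
    have hd : 0 < d := Nat.pos_of_ne_zero (right_ne_zero_of_mul hv)
    have : (q * d).gcd (h * d) = d := by rw [Nat.gcd_mul_right, hco.gcd_eq_one, one_mul]
    simp only [Nat.mul_div_cancel_left d hq, this, Nat.mul_div_cancel _ hd]
  · intro h hh
    have hg : 0 < v.gcd h := Nat.gcd_pos_of_pos_left _ (Nat.pos_of_ne_zero hv)
    have hg' : ((v.gcd h : ℕ) : ℝ) ≠ 0 := by exact_mod_cast hg.ne'
    simp only
    rw [Nat.cast_div (Nat.gcd_dvd_right _ _) hg', Nat.cast_div (Nat.gcd_dvd_left _ _) hg',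
      div_div_div_cancel_right₀ hg']

lemma sum_divisors_sum_unitExp {v : ℕ} (hv : v ≠ 0) (n : ℤ) :
    ∑ q ∈ v.divisors, ∑ h ∈ reducedResidues q, unitExp ((h : ℝ) / q * n) =
      if (v : ℤ) ∣ n then (v : ℂ) else 0 := by
  rw [← sum_range_unitExp hv, sum_range_div_eq_sum_divisors (fun t => unitExp (t * n)) hv]

/-- Multiplication by the unit t permutes the reduced residues. -/
lemma sum_reducedResidues_mul {q : ℕ} {t : ℤ} (ht : IsCoprime t q) (n : ℤ) :
    ∑ h ∈ reducedResidues q, unitExp ((h : ℝ) / q * (t * n : ℤ)) =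
      ∑ h ∈ reducedResidues q, unitExp ((h : ℝ) / q * n) := by
  rcases Nat.eq_zero_or_pos q with rfl | hq
  · simp [reducedResidues]
  have hq' : (q : ℤ) ≠ 0 := by exact_mod_cast hq.ne'
  have hcast : ∀ h : ℕ, (((h * t % q).toNat : ℕ) : ℤ) = h * t % q := fun h =>
    Int.toNat_of_nonneg (Int.emod_nonneg _ hq')
  have hmaps : ∀ h ∈ reducedResidues q, (h * t % q).toNat ∈ reducedResidues q := by
    intro h hh
    rw [mem_reducedResidues] at hh ⊢
    constructor
    · have := Int.emod_lt_of_pos (h * t) (by exact_mod_cast hq : (0 : ℤ) < q)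
      have h2 := hcast h
      omega
    · rw [← Nat.isCoprime_iff_coprime, hcast, isCoprime_comm]
      have h1 : IsCoprime ((h : ℤ) * t) q :=
        IsCoprime.mul_left (Nat.isCoprime_iff_coprime.2 hh.2).symm ht
      rw [Int.emod_def, sub_eq_add_neg, ← mul_neg]
      exact h1.add_mul_left_left _
  have hinj : Set.InjOn (fun h : ℕ => (h * t % q).toNat) (reducedResidues q) := by
    intro a ha b hb hab
    rw [mem_coe, mem_reducedResidues] at ha hb
    have h1 : (a * t % q : ℤ) = b * t % q := by
      rw [← hcast a, ← hcast b]; exact congrArg (Nat.cast (R := ℤ)) hab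
    have h2 : (q : ℤ) ∣ (a - b) * t := by
      rw [sub_mul]
      exact Int.ModEq.dvd (show (b * t : ℤ) ≡ a * t [ZMOD q] from h1.symm)
    have h3 : (q : ℤ) ∣ a - b := ht.symm.dvd_of_dvd_mul_right h2
    have h4 : (a : ℤ) - b = 0 := Int.eq_zero_of_abs_lt_dvd h3 (by
      rw [abs_lt]; omega)
    omega
  symm
  refine (Finset.sum_nbij (fun h : ℕ => (h * t % q).toNat) hmaps hinj
    (Finset.surjOn_of_injOn_of_card_le _ hmaps hinj le_rfl) ?_).symm
  intro h hh
  have e1 : ((h : ℝ) / q * (t * n : ℤ)) = ((h * t * n : ℤ) : ℝ) / q := by push_cast; ring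
  have e2 : (((h * t % q).toNat : ℝ) / q * n) = (((h * t % q) * n : ℤ) : ℝ) / q := by
    have : (((h * t % q).toNat : ℕ) : ℝ) = ((h * t % q : ℤ) : ℝ) := by
      rw [← hcast]; norm_cast
    rw [this]; push_cast; ring
  rw [e1, e2]
  exact unitExp_div_congr hq.ne' ((Int.mod_modEq _ _).symm.mul_right _)

/-! ### Mean squares over reduced fractions -/

lemma norm_sq_sum_unitExp {ι : Type*} (s : Finset ι) (f : ι → ℤ) (θ : ℝ) :
    ((‖∑ i ∈ s, unitExp (θ * f i)‖ ^ 2 : ℝ) : ℂ) =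
      ∑ i ∈ s, ∑ j ∈ s, unitExp (θ * (f i - f j : ℤ)) := by
  push_cast
  rw [← Complex.mul_conj', map_sum, Finset.sum_mul_sum]
  refine sum_congr rfl fun i _ => sum_congr rfl fun j _ => ?_
  rw [conj_unitExp, ← unitExp_add]
  congr 1
  ring

/-- Replacing integers by their inverses modulo `q` does not change the mean square of an
exponential sum over the reduced fractions with denominator `q`. -/
lemma sum_norm_sq_inverse {q : ℕ} {s : Finset ℕ} {inv : ℕ → ℤ}
    (hinv : ∀ u ∈ s, (q : ℤ) ∣ u * inv u - 1) :
    ∑ h ∈ reducedResidues q, ‖∑ u ∈ s, unitExp ((h : ℝ) / q * (-inv u : ℤ))‖ ^ 2 =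
      ∑ h ∈ reducedResidues q, ‖∑ u ∈ s, unitExp ((h : ℝ) / q * (u : ℤ))‖ ^ 2 := by
  rw [← Complex.ofReal_inj]
  rw [Complex.ofReal_sum, Complex.ofReal_sum]
  simp_rw [norm_sq_sum_unitExp _ (fun u : ℕ => -inv u), norm_sq_sum_unitExp _ (fun u : ℕ => (u : ℤ))]
  rw [sum_comm]
  conv_rhs => rw [sum_comm]
  refine sum_congr rfl fun u hu => ?_
  rw [sum_comm]
  conv_rhs => rw [sum_comm]
  refine sum_congr rfl fun w hw => ?_
  have hcop : ∀ u ∈ s, IsCoprime (inv u) (q : ℤ) := by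
    intro u hu
    obtain ⟨c, hc⟩ := hinv u hu
    exact ⟨u, -c, by linarith⟩
  -- Modulo q, `inv w - inv u` equals (u - w) times the unit `inv u * inv w`.
  rw [← sum_reducedResidues_mul ((hcop u hu).mul_left (hcop w hw)) ((u : ℤ) - w)]
  refine sum_congr rfl fun h hh => ?_
  have hq : q ≠ 0 := by
    rintro rfl; simp [reducedResidues] at hh
  have e : ∀ n : ℤ, (h : ℝ) / q * n = ((h * n : ℤ) : ℝ) / q := by intro n; push_cast; ring
  rw [e, e]
  apply unitExp_div_congr hq
  apply Int.ModEq.mul_left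
  obtain ⟨c, hc⟩ := hinv u hu
  obtain ⟨d, hd⟩ := hinv w hw
  rw [Int.modEq_iff_dvd]
  refine ⟨c * inv w - d * inv u, ?_⟩
  linear_combination inv w * hc - inv u * hd

lemma card_filter_dvd_sub_le {q : ℕ} (hq : 0 < q) (X : ℕ) (x : ℕ) :
    (#{y ∈ Icc 1 X | (q : ℤ) ∣ (x : ℤ) - (y : ℕ)} : ℝ) ≤ X / q + 1 := by
  have h := Int.Ioc_filter_modEq_card (a := 0) (b := (X : ℤ)) (r := q) (by exact_mod_cast hq) x
  have h2 : #{y ∈ Icc 1 X | (q : ℤ) ∣ (x : ℤ) - (y : ℕ)} =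
      #{y ∈ Ioc (0 : ℤ) X | y ≡ x [ZMOD q]} := by
    refine Finset.card_nbij (fun y : ℕ => (y : ℤ)) ?_ ?_ ?_
    · intro y hy
      simp only [coe_filter, mem_Icc, Set.mem_ofPred_eq, mem_Ioc] at hy ⊢
      exact ⟨by omega, (Int.modEq_iff_dvd).2 hy.2⟩
    · intro a _ b _ hab
      exact Int.ofNat_inj.1 hab
    · intro y hy
      simp only [coe_filter, mem_Icc, Set.mem_ofPred_eq, mem_Ioc, Set.mem_image] at hy ⊢
      refine ⟨y.toNat, ⟨by omega, ?_⟩, by omega⟩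
      rw [Int.toNat_of_nonneg (by omega)]
      exact (Int.modEq_iff_dvd).1 hy.2
  rw [h2]
  have hq' : (0 : ℚ) < q := by exact_mod_cast hq
  have h3 : (#{y ∈ Ioc (0 : ℤ) X | y ≡ x [ZMOD q]} : ℤ) ≤ ⌊(X : ℚ) / q⌋ + 1 := by
    rw [h]
    apply max_le _ (by positivity)
    have e : ((X : ℤ) - ((x : ℕ) : ℤ) : ℚ) / ((q : ℕ) : ℤ) = X / q + (0 - (x : ℕ) : ℚ) / q := by
      push_cast; field_simp; ring
    have := Int.le_floor_add_floor ((X : ℚ) / q) ((0 - (x : ℕ) : ℚ) / q)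
    push_cast at e ⊢
    rw [e]
    linarith
  have h4 : ((⌊(X : ℚ) / q⌋ : ℤ) : ℚ) ≤ (X : ℚ) / q := Int.floor_le _
  have h5 : (#{y ∈ Ioc (0 : ℤ) X | y ≡ x [ZMOD q]} : ℚ) ≤ (X : ℚ) / q + 1 := by
    have : ((#{y ∈ Ioc (0 : ℤ) X | y ≡ x [ZMOD q]} : ℤ) : ℚ) ≤ ((⌊(X : ℚ) / q⌋ + 1 : ℤ) : ℚ) := by
      exact_mod_cast h3
    push_cast at this
    linarith
  have : (((#{y ∈ Ioc (0 : ℤ) X | y ≡ x [ZMOD q]} : ℚ)) : ℝ) ≤ (((X : ℚ) / q + 1 : ℚ) : ℝ) := by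
    exact_mod_cast h5
  simpa using this

/-- Parseval over all residues gives at most X² + qX. The residue 0, not reduced since q ≥ 2,
accounts for exactly X². -/
lemma sum_norm_sq_interval_le {q : ℕ} (hq : 2 ≤ q) (X : ℕ) :
    ∑ h ∈ reducedResidues q, ‖∑ x ∈ Icc 1 X, unitExp ((h : ℝ) / q * (x : ℤ))‖ ^ 2 ≤
      (q : ℝ) * X := by
  have hq0 : q ≠ 0 := by omega
  have hall : ∑ h ∈ range q, ‖∑ x ∈ Icc 1 X, unitExp ((h : ℝ) / q * (x : ℤ))‖ ^ 2 ≤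
      q * (X * ((X : ℝ) / q + 1)) := by
    have e : ∑ h ∈ range q, ‖∑ x ∈ Icc 1 X, unitExp ((h : ℝ) / q * (x : ℤ))‖ ^ 2 =
        q * ∑ x ∈ Icc 1 X, (#{y ∈ Icc 1 X | (q : ℤ) ∣ (x : ℤ) - (y : ℕ)} : ℝ) := by
      rw [← Complex.ofReal_inj]
      rw [Complex.ofReal_sum]
      push_cast [-Complex.ofReal_pow]
      simp_rw [← Int.cast_natCast (R := ℝ), norm_sq_sum_unitExp _ (fun u : ℕ => (u : ℤ))]
      rw [sum_comm, mul_sum]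
      refine sum_congr rfl fun x _ => ?_
      rw [sum_comm]
      simp_rw [Int.cast_natCast, sum_range_unitExp hq0]
      rw [← sum_filter, sum_const, nsmul_eq_mul, mul_comm]
    rw [e]
    gcongr
    calc _ ≤ ∑ x ∈ Icc 1 X, ((X : ℝ) / q + 1) :=
          sum_le_sum fun x _ => card_filter_dvd_sub_le (by omega) X x
      _ = _ := by simp; ring
  have hsub : reducedResidues q ⊆ (range q).erase 0 := by
    intro h hh
    rw [mem_reducedResidues] at hh
    refine mem_erase.2 ⟨?_, mem_range.2 hh.1⟩
    rintro rfl
    have := (Nat.coprime_zero_right q).1 hh.2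
    omega
  have h0 := add_sum_erase (range q)
    (fun h : ℕ => ‖∑ x ∈ Icc 1 X, unitExp ((h : ℝ) / q * (x : ℤ))‖ ^ 2) (mem_range.2 (by omega : 0 < q))
  have hz : ‖∑ x ∈ Icc 1 X, unitExp (((0 : ℕ) : ℝ) / q * (x : ℤ))‖ ^ 2 = (X : ℝ) ^ 2 := by
    simp [unitExp_zero]
  have h1 : ∑ h ∈ reducedResidues q, ‖∑ x ∈ Icc 1 X, unitExp ((h : ℝ) / q * (x : ℤ))‖ ^ 2 ≤
      ∑ h ∈ (range q).erase 0, ‖∑ x ∈ Icc 1 X, unitExp ((h : ℝ) / q * (x : ℤ))‖ ^ 2 :=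
    sum_le_sum_of_subset_of_nonneg hsub fun _ _ _ => by positivity
  rw [hz] at h0
  have hqr : (q : ℝ) ≠ 0 := by exact_mod_cast hq0
  have h2 : (q : ℝ) * (X * ((X : ℝ) / q + 1)) = X ^ 2 + q * X := by field_simp
  linarith

/-! ### Geometric sums and the large sieve -/

lemma norm_unitExp_sub_one (t : ℝ) : ‖unitExp t - 1‖ = 2 * |Real.sin (Real.pi * t)| := by
  have h := Complex.norm_exp_I_mul_ofReal_sub_one (2 * Real.pi * t)
  have e : Complex.I * ((2 * Real.pi * t : ℝ) : ℂ) = 2 * Real.pi * t * Complex.I := by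
    push_cast; ring
  rw [e] at h
  rw [unitExp, h, Real.norm_eq_abs, abs_mul, abs_two]
  congr 3
  ring

lemma four_mul_le_norm_unitExp_sub_one {t : ℝ} (h0 : 0 ≤ t) (h1 : t ≤ 1 / 2) :
    4 * t ≤ ‖unitExp t - 1‖ := by
  have hpi := Real.pi_pos
  have h := Real.mul_le_sin (x := Real.pi * t) (by positivity) (by nlinarith)
  have e : 2 / Real.pi * (Real.pi * t) = 2 * t := by field_simp
  rw [e] at h
  rw [norm_unitExp_sub_one]
  have := le_abs_self (Real.sin (Real.pi * t))
  linarith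

lemma unitExp_add_int (t : ℝ) (n : ℤ) : unitExp (t + n) = unitExp t := by
  rw [unitExp_add, unitExp_int, mul_one]

/-- The geometric sum `∑_{n < N} exp (2πint)`. -/
noncomputable def geomExp (N : ℕ) (t : ℝ) : ℂ := ∑ n ∈ range N, unitExp (n * t)

lemma norm_geomExp_le_card (N : ℕ) (t : ℝ) : ‖geomExp N t‖ ≤ N := by
  refine (norm_sum_le _ _).trans ?_
  simp [norm_unitExp]

lemma norm_geomExp_mul_le (N : ℕ) (t : ℝ) : ‖geomExp N t‖ * ‖unitExp t - 1‖ ≤ 2 := by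
  rw [← norm_mul, geomExp]
  simp_rw [unitExp_natMul]
  rw [geom_sum_mul, ← unitExp_natMul]
  refine (norm_sub_le _ _).trans ?_
  rw [norm_unitExp, norm_one]
  norm_num

lemma geomExp_add_int (N : ℕ) (t : ℝ) (k : ℤ) : geomExp N (t + k) = geomExp N t := by
  unfold geomExp
  simp_rw [unitExp_natMul, unitExp_add_int]

lemma norm_geomExp_neg (N : ℕ) (t : ℝ) : ‖geomExp N (-t)‖ = ‖geomExp N t‖ := by
  rw [← RCLike.norm_conj (geomExp N t), geomExp, geomExp, map_sum]
  simp_rw [conj_unitExp, mul_neg]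

/-- A majorant of the geometric sum at distance `c / M` from the integers. -/
noncomputable def cellBound (N M c : ℕ) : ℝ := if c = 0 then N else M / (2 * c)

lemma cellBound_nonneg (N M c : ℕ) : 0 ≤ cellBound N M c := by
  unfold cellBound; split_ifs <;> positivity

lemma norm_geomExp_le_cellBound {N M c : ℕ} {t : ℝ} (hM : 0 < M) (h1 : t ≤ 1 / 2)
    (hc : c ≤ t * M) : ‖geomExp N t‖ ≤ cellBound N M c := by
  unfold cellBound
  split_ifs with h
  · exact norm_geomExp_le_card N t
  · have hc0 : (0 : ℝ) < c := by exact_mod_cast Nat.pos_of_ne_zero h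
    have hM' : (0 : ℝ) < M := by exact_mod_cast hM
    have ht : 0 < t := by
      by_contra hneg
      nlinarith
    rw [le_div_iff₀ (by positivity)]
    have h2 := norm_geomExp_mul_le N t
    have h3 := four_mul_le_norm_unitExp_sub_one ht.le h1
    have h4 : ‖geomExp N t‖ * (4 * t) ≤ 2 :=
      (mul_le_mul_of_nonneg_left h3 (norm_nonneg _)).trans h2
    have h5 : ‖geomExp N t‖ * (2 * c) ≤ ‖geomExp N t‖ * (2 * (t * M)) := by gcongr
    nlinarith

lemma sum_cellBound_le {N M : ℕ} (hM : 0 < M) :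
    ∑ c ∈ range M, cellBound N M c ≤ N + M / 2 * (1 + Real.log M) := by
  obtain ⟨M, rfl⟩ := Nat.exists_eq_succ_of_ne_zero hM.ne'
  rw [sum_range_succ']
  have h0 : cellBound N (M + 1) 0 = N := by simp [cellBound]
  have h1 : ∑ c ∈ range M, cellBound N (M + 1) (c + 1) = ((M + 1 : ℕ) : ℝ) / 2 * (harmonic M : ℝ) := by
    rw [harmonic]
    push_cast
    rw [mul_sum]
    refine sum_congr rfl fun c _ => ?_
    have : (c : ℝ) + 1 ≠ 0 := by positivity
    simp only [cellBound, Nat.succ_ne_zero, if_false]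
    push_cast
    field_simp
  have h2 : (harmonic M : ℝ) ≤ 1 + Real.log (M + 1 : ℕ) := by
    have : (harmonic M : ℝ) ≤ (harmonic (M + 1) : ℝ) := by
      rw [harmonic_succ]; push_cast
      have : (0 : ℝ) ≤ ((M : ℝ) + 1)⁻¹ := by positivity
      linarith
    exact this.trans (harmonic_le_one_add_log (M + 1))
  rw [h0, h1, Nat.succ_eq_add_one]
  have : ((M + 1 : ℕ) : ℝ) / 2 * (harmonic M : ℝ) ≤ ((M + 1 : ℕ) : ℝ) / 2 * (1 + Real.log (M + 1 : ℕ)) := by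
    gcongr
  linarith

/-- The total size of the geometric sums at the differences of a well-spaced set of points. -/
lemma sum_norm_geomExp_le {ι : Type*} {s : Finset ι} {θ : ι → ℝ} {M : ℕ} (hM : 0 < M)
    (hsep : ∀ i ∈ s, ∀ j ∈ s, i ≠ j → ∀ n : ℤ, 1 / (M : ℝ) ≤ |θ i - θ j - n|) (N : ℕ) (a : ℝ) :
    ∑ j ∈ s, ‖geomExp N (θ j - a)‖ ≤ 2 * N + M * (1 + Real.log M) := by
  have hM' : (0 : ℝ) < M := by exact_mod_cast hM
  set f : ι → ℝ := fun j => Int.fract (θ j - a) with hf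
  have hf0 : ∀ j, 0 ≤ f j := fun j => Int.fract_nonneg _
  have hf1 : ∀ j, f j < 1 := fun j => Int.fract_lt_one _
  -- The circle is cut into M cells of length 1 / M; by the spacing each holds at most one point.
  set c : ι → ℕ := fun j => ⌊f j * M⌋₊ with hc
  have hcle : ∀ j, (c j : ℝ) ≤ f j * M := fun j => Nat.floor_le (by have := hf0 j; positivity)
  have hclt : ∀ j, f j * M < c j + 1 := fun j => Nat.lt_floor_add_one _
  have hcM : ∀ j, c j < M := by
    intro j
    have h1 := hcle j
    have h2 : f j * M < M := by nlinarith [hf1 j]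
    exact_mod_cast h1.trans_lt h2
  have hinj : Set.InjOn c s := by
    intro i hi j hj hij
    by_contra hne
    have h := hsep i hi j hj hne (⌊θ i - a⌋ - ⌊θ j - a⌋)
    have e : θ i - θ j - ((⌊θ i - a⌋ - ⌊θ j - a⌋ : ℤ) : ℝ) = f i - f j := by
      simp only [hf, Int.fract]; push_cast; ring
    have hab : |f i - f j| * M = |f i * M - f j * M| := by
      rw [← sub_mul, abs_mul, abs_of_pos hM']
    rw [e, div_le_iff₀ hM', hab] at h
    have h3 := hcle i; have h4 := hcle j; have h5 := hclt i; have h6 := hclt j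
    rw [hij] at h3 h5
    have : |f i * M - f j * M| < 1 := by rw [abs_lt]; constructor <;> linarith
    linarith
  -- The two terms cover points nearer to 0 and points nearer to 1, the latter reflected by t ↦ 1 -
  -- t.
  have hbd : ∀ j, ‖geomExp N (θ j - a)‖ ≤ cellBound N M (c j) + cellBound N M (M - 1 - c j) := by
    intro j
    have e : geomExp N (θ j - a) = geomExp N (f j) := by
      rw [← geomExp_add_int N (f j) ⌊θ j - a⌋, hf]
      simp only [Int.fract_add_floor]
    rw [e]
    rcases le_total (f j) (1 / 2) with h | h
    · have := norm_geomExp_le_cellBound (N := N) hM h (hcle j)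
      have := cellBound_nonneg N M (M - 1 - c j)
      linarith
    · have e2 : ‖geomExp N (f j)‖ = ‖geomExp N (1 - f j)‖ := by
        rw [← norm_geomExp_neg, ← geomExp_add_int N (-f j) 1]
        congr 2
        push_cast; ring
      rw [e2]
      have hcast : ((M - 1 - c j : ℕ) : ℝ) = M - 1 - c j := by
        have := hcM j
        rw [Nat.cast_sub (by omega), Nat.cast_sub (by omega)]
        simp
      have := norm_geomExp_le_cellBound (N := N) (M := M) (c := M - 1 - c j) (t := 1 - f j) hM
        (by linarith) (by rw [hcast]; nlinarith [hclt j])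
      have := cellBound_nonneg N M (c j)
      linarith
  calc ∑ j ∈ s, ‖geomExp N (θ j - a)‖
      ≤ ∑ j ∈ s, (cellBound N M (c j) + cellBound N M (M - 1 - c j)) :=
        sum_le_sum fun j _ => hbd j
    _ = ∑ d ∈ s.image c, (cellBound N M d + cellBound N M (M - 1 - d)) := by
        rw [sum_image hinj]
    _ ≤ ∑ d ∈ range M, (cellBound N M d + cellBound N M (M - 1 - d)) := by
        refine sum_le_sum_of_subset_of_nonneg ?_ fun d _ _ =>
          add_nonneg (cellBound_nonneg _ _ _) (cellBound_nonneg _ _ _)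
        intro d hd
        obtain ⟨j, -, rfl⟩ := mem_image.1 hd
        exact mem_range.2 (hcM j)
    _ = 2 * ∑ d ∈ range M, cellBound N M d := by
        rw [sum_add_distrib, sum_range_reflect, two_mul]
    _ ≤ _ := by
        have := sum_cellBound_le (N := N) hM
        linarith

/-- A large sieve inequality for well-spaced points, with a logarithmic loss. -/
theorem large_sieve {ι : Type*} {s : Finset ι} {θ : ι → ℝ} {M : ℕ} (hM : 0 < M)
    (hsep : ∀ i ∈ s, ∀ j ∈ s, i ≠ j → ∀ n : ℤ, 1 / (M : ℝ) ≤ |θ i - θ j - n|) {N : ℕ}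
    {A : Finset ℕ} (hA : A ⊆ range N) :
    ∑ i ∈ s, ‖∑ u ∈ A, unitExp (θ i * (u : ℤ))‖ ^ 2 ≤
      (2 * N + M * (1 + Real.log M)) * #A := by
  set R : ℝ := 2 * N + M * (1 + Real.log M) with hR
  set S : ι → ℂ := fun i => ∑ u ∈ A, unitExp (θ i * (u : ℤ)) with hS
  set T : ℝ := ∑ i ∈ s, ‖S i‖ ^ 2 with hT
  have hT0 : 0 ≤ T := sum_nonneg fun _ _ => by positivity
  -- Duality: T is the sum of W over A. After Cauchy-Schwarz, A is enlarged to the whole interval,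
  -- so that the sums over n become geometric.
  set W : ℕ → ℂ := fun n => ∑ i ∈ s, (starRingEnd ℂ) (S i) * unitExp (θ i * (n : ℤ)) with hW
  have hTW : (T : ℂ) = ∑ u ∈ A, W u := by
    simp only [hT, hW]
    rw [sum_comm]
    push_cast
    refine sum_congr rfl fun i _ => ?_
    rw [← mul_sum, ← Complex.conj_mul']
    simp [hS]
  have h1 : T ^ 2 ≤ #A * ∑ n ∈ range N, ‖W n‖ ^ 2 := by
    have h : T ≤ ∑ u ∈ A, ‖W u‖ := by
      calc T = ‖(T : ℂ)‖ := by rw [Complex.norm_real, Real.norm_of_nonneg hT0]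
        _ ≤ _ := by rw [hTW]; exact norm_sum_le _ _
    calc T ^ 2 ≤ (∑ u ∈ A, ‖W u‖) ^ 2 := by gcongr
      _ ≤ #A * ∑ u ∈ A, ‖W u‖ ^ 2 := sq_sum_le_card_mul_sum_sq
      _ ≤ _ := by
        gcongr
  have h2 : ∑ n ∈ range N, ‖W n‖ ^ 2 ≤ R * T := by
    have e : ((∑ n ∈ range N, ‖W n‖ ^ 2 : ℝ) : ℂ) =
        ∑ i ∈ s, ∑ j ∈ s, (starRingEnd ℂ) (S i) * S j * geomExp N (θ i - θ j) := by
      push_cast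
      simp only [geomExp, mul_sum]
      simp_rw [← Complex.mul_conj', hW, map_sum, Finset.sum_mul_sum]
      rw [sum_comm]
      refine sum_congr rfl fun i _ => ?_
      rw [sum_comm]
      refine sum_congr rfl fun j _ => sum_congr rfl fun n _ => ?_
      rw [map_mul, Complex.conj_conj, conj_unitExp]
      have : unitExp (n * (θ i - θ j)) = unitExp (θ i * (n : ℤ)) * unitExp (-(θ j * (n : ℤ))) := by
        rw [← unitExp_add]
        congr 1
        push_cast; ring
      rw [this]
      ring
    have h3 : ∑ n ∈ range N, ‖W n‖ ^ 2 ≤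
        ∑ i ∈ s, ∑ j ∈ s, (‖S i‖ ^ 2 / 2 * ‖geomExp N (θ j - θ i)‖ +
          ‖S j‖ ^ 2 / 2 * ‖geomExp N (θ i - θ j)‖) := by
      have hn : ∑ n ∈ range N, ‖W n‖ ^ 2 = ‖((∑ n ∈ range N, ‖W n‖ ^ 2 : ℝ) : ℂ)‖ := by
        rw [Complex.norm_real, Real.norm_of_nonneg (sum_nonneg fun _ _ => by positivity)]
      rw [hn, e]
      refine (norm_sum_le _ _).trans (sum_le_sum fun i _ => (norm_sum_le _ _).trans
        (sum_le_sum fun j _ => ?_))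
      rw [norm_mul, norm_mul, RCLike.norm_conj, ← norm_geomExp_neg N (θ j - θ i), neg_sub,
        ← add_mul]
      gcongr
      nlinarith [sq_nonneg (‖S i‖ - ‖S j‖)]
    refine h3.trans ?_
    simp_rw [sum_add_distrib]
    rw [sum_comm (f := fun i j => ‖S j‖ ^ 2 / 2 * ‖geomExp N (θ i - θ j)‖)]
    simp_rw [← mul_sum]
    have h4 : ∑ i ∈ s, ‖S i‖ ^ 2 / 2 * ∑ j ∈ s, ‖geomExp N (θ j - θ i)‖ ≤ R * T / 2 := by
      calc _ ≤ ∑ i ∈ s, ‖S i‖ ^ 2 / 2 * R := by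
            refine sum_le_sum fun i _ => ?_
            gcongr
            exact sum_norm_geomExp_le hM hsep N (θ i)
        _ = _ := by rw [← sum_mul, ← sum_div]; ring
    linarith
  have h3 : T * T ≤ (R * #A) * T := by
    calc T * T = T ^ 2 := by ring
      _ ≤ #A * ∑ n ∈ range N, ‖W n‖ ^ 2 := h1
      _ ≤ #A * (R * T) := by gcongr
      _ = _ := by ring
  rcases hT0.eq_or_lt with h | h
  · have hR0 : 0 ≤ R := by
      have : 0 ≤ Real.log M := Real.log_natCast_nonneg M
      positivity
    rw [← h]
    positivity
  · exact le_of_mul_le_mul_right h3 h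

/-- The large sieve inequality for the reduced fractions with denominators in a set. -/
theorem large_sieve_fractions {Q : Finset ℕ} {K : ℕ} (hK : 0 < K) (hQ : ∀ q ∈ Q, q ≤ K) {N : ℕ}
    {A : Finset ℕ} (hA : A ⊆ range N) :
    ∑ q ∈ Q, ∑ h ∈ reducedResidues q, ‖∑ u ∈ A, unitExp ((h : ℝ) / q * (u : ℤ))‖ ^ 2 ≤
      (2 * N + (K ^ 2 : ℕ) * (1 + Real.log (K ^ 2 : ℕ))) * #A := by
  rw [Finset.sum_sigma']
  refine large_sieve (θ := fun x : (_ : ℕ) × ℕ => (x.2 : ℝ) / x.1) (by positivity) ?_ hA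
  rintro ⟨q, h⟩ hx ⟨r, l⟩ hy hne n
  simp only [mem_sigma, mem_reducedResidues] at hx hy ⊢
  obtain ⟨hqQ, hlt, hco⟩ := hx
  obtain ⟨hrQ, hlt', hco'⟩ := hy
  have hq0 : 0 < q := by omega
  have hr0 : 0 < r := by omega
  have hq : (0 : ℝ) < q := by exact_mod_cast hq0
  have hr : (0 : ℝ) < r := by exact_mod_cast hr0
  have e : (h : ℝ) / q - l / r - n = ((h * r - l * q - n * q * r : ℤ) : ℝ) / (q * r) := by
    push_cast; field_simp
  -- Distinct reduced fractions differ modulo 1 by a nonzero multiple of 1 / (q r), hence by at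
  -- least 1 / K².
  have hne0 : (h * r - l * q - n * q * r : ℤ) ≠ 0 := by
    intro h0
    have h1 : (q : ℤ) ∣ r := by
      have : (q : ℤ) ∣ h * r := ⟨l + n * r, by linarith⟩
      exact (Nat.isCoprime_iff_coprime.2 hco).dvd_of_dvd_mul_left this
    have h2 : (r : ℤ) ∣ q := by
      have : (r : ℤ) ∣ l * q := ⟨h - n * q, by linarith⟩
      exact (Nat.isCoprime_iff_coprime.2 hco').dvd_of_dvd_mul_left this
    have hqr : q = r := Nat.dvd_antisymm (by exact_mod_cast h1) (by exact_mod_cast h2)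
    subst hqr
    have h3 : (h - l - n * q : ℤ) = 0 := by
      have : (h - l - n * q : ℤ) * q = 0 := by linarith
      exact (mul_eq_zero.1 this).resolve_right (by exact_mod_cast hq0.ne')
    have h4 : (h - l : ℤ) = 0 := Int.eq_zero_of_abs_lt_dvd (m := (q : ℤ)) ⟨n, by linarith⟩ (by
      rw [abs_lt]; omega)
    apply hne
    have : h = l := by omega
    rw [this]
  rw [e, abs_div, abs_of_pos (mul_pos hq hr)]
  have h5 : (1 : ℝ) ≤ |((h * r - l * q - n * q * r : ℤ) : ℝ)| := by
    rw [← Int.cast_abs]; exact_mod_cast Int.one_le_abs hne0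
  have h6 : (q * r : ℝ) ≤ (K ^ 2 : ℕ) := by
    have := Nat.mul_le_mul (hQ q hqQ) (hQ r hrQ)
    rw [sq]; exact_mod_cast this
  exact div_le_div₀ (by positivity) h5 (by positivity) h6

/-! ### Inverses modulo products of primes -/

lemma sum_divisors_prod_primes {M : Type*} [AddCommMonoid M] {B : Finset ℕ}
    (hB : ∀ p ∈ B, p.Prime) (G : ℕ → M) :
    ∑ q ∈ (∏ p ∈ B, p).divisors, G q = ∑ C ∈ B.powerset, G (∏ p ∈ C, p) := by
  have hne : (∏ p ∈ B, p) ≠ 0 := prod_ne_zero_iff.2 fun p hp => (hB p hp).ne_zero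
  have hsq : Squarefree (∏ p ∈ B, p) := by
    refine Finset.squarefree_prod_of_pairwise_isCoprime ?_ fun p hp => (hB p hp).squarefree
    intro p hp q hq hpq
    exact Nat.coprime_iff_isRelPrime.1 ((Nat.coprime_primes (hB p hp) (hB q hq)).2 hpq)
  refine Finset.sum_nbij' (fun q => q.primeFactors) (fun C => ∏ p ∈ C, p) ?_ ?_ ?_ ?_ ?_
  · intro q hq
    rw [Nat.mem_divisors] at hq
    rw [mem_powerset, ← Nat.primeFactors_prod hB]
    exact Nat.primeFactors_mono hq.1 hne
  · intro C hC
    rw [Nat.mem_divisors]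
    exact ⟨prod_dvd_prod_of_subset _ _ _ (mem_powerset.1 hC), hne⟩
  · intro q hq
    exact Nat.prod_primeFactors_of_squarefree (hsq.squarefree_of_dvd (Nat.mem_divisors.1 hq).1)
  · intro C hC
    exact Nat.primeFactors_prod fun p hp => hB p (mem_powerset.1 hC hp)
  · intro q hq
    rw [Nat.prod_primeFactors_of_squarefree (hsq.squarefree_of_dvd (Nat.mem_divisors.1 hq).1)]

/-- Bounds how many moduli v share a given denominator q; B is recovered from B \ C. -/
lemma card_filter_subset_le {P C : Finset ℕ} (hC : C ⊆ P) (m : ℕ) :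
    #{B ∈ P.powersetCard m | C ⊆ B} ≤ (#P - #C).choose (m - #C) := by
  rw [← card_sdiff_of_subset hC, ← card_powersetCard]
  refine card_le_card_of_injOn (fun B => B \ C) ?_ ?_
  · intro B hB
    simp only [coe_filter, mem_powersetCard, Set.mem_ofPred_eq] at hB
    rw [mem_coe, mem_powersetCard, card_sdiff_of_subset hB.2, hB.1.2]
    exact ⟨sdiff_subset_sdiff hB.1.1 le_rfl, rfl⟩
  · intro B hB B' hB' h
    simp only [coe_filter, mem_powersetCard, Set.mem_ofPred_eq] at hB hB'
    simp only at h
    rw [← sdiff_union_of_subset hB.2, h, sdiff_union_of_subset hB'.2]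

/-- The contribution of the fractions with denominator `q` to the number of solutions of
`u * x ≡ 1`. -/
noncomputable def fractionTerm (A : Finset ℕ) (inv : ℕ → ℤ) (X q : ℕ) : ℂ :=
  ∑ h ∈ reducedResidues q, (∑ x ∈ Icc 1 X, unitExp ((h : ℝ) / q * (x : ℤ))) *
    ∑ u ∈ A, unitExp ((h : ℝ) / q * (-inv u : ℤ))

/-- The pairs `(u, x)` with `u ∈ A`, `1 ≤ x ≤ X` and `u * x ≡ 1` modulo `v`. -/
def inversePairs (A : Finset ℕ) (X v : ℕ) : Finset (ℕ × ℕ) :=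
  {w ∈ A ×ˢ Icc 1 X | (v : ℤ) ∣ (w.1 : ℤ) * w.2 - 1}

/-- The congruence ux ≡ 1 means x ≡ `inv u`, which orthogonality of characters modulo v detects. -/
lemma mul_card_inversePairs {A : Finset ℕ} {inv : ℕ → ℤ} {v : ℕ} (hv : v ≠ 0)
    (hinv : ∀ u ∈ A, (v : ℤ) ∣ u * inv u - 1) (X : ℕ) :
    (v : ℂ) * #(inversePairs A X v) = ∑ q ∈ v.divisors, fractionTerm A inv X q := by
  have e : ∀ u ∈ A, ∀ x : ℕ, ((v : ℤ) ∣ (u : ℤ) * x - 1 ↔ (v : ℤ) ∣ (x : ℤ) + -inv u) := by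
    intro u hu x
    obtain ⟨c, hc⟩ := hinv u hu
    constructor
    · rintro ⟨d, hd⟩
      exact ⟨inv u * d - x * c, by linear_combination inv u * hd - x * hc⟩
    · rintro ⟨d, hd⟩
      exact ⟨u * d + c, by linear_combination u * hd + hc⟩
  have h1 : (v : ℂ) * #(inversePairs A X v) =
      ∑ u ∈ A, ∑ x ∈ Icc 1 X, if (v : ℤ) ∣ (x : ℤ) + -inv u then (v : ℂ) else 0 := by
    rw [inversePairs, card_filter, sum_product]
    push_cast
    rw [mul_sum]
    refine sum_congr rfl fun u hu => ?_
    rw [mul_sum]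
    refine sum_congr rfl fun x _ => ?_
    simp only [e u hu x, mul_ite, mul_one, mul_zero]
  rw [h1]
  simp_rw [← sum_divisors_sum_unitExp hv, fractionTerm]
  simp_rw [sum_comm (t := v.divisors)]
  refine sum_congr rfl fun q _ => ?_
  simp_rw [sum_comm (t := reducedResidues q)]
  refine sum_congr rfl fun h _ => ?_
  rw [sum_mul_sum, sum_comm]
  refine sum_congr rfl fun x _ => sum_congr rfl fun u _ => ?_
  rw [← unitExp_add]
  congr 1
  push_cast; ring

lemma fractionTerm_one (A : Finset ℕ) (inv : ℕ → ℤ) (X : ℕ) :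
    fractionTerm A inv X 1 = (X : ℂ) * #A := by
  have : reducedResidues 1 = {0} := by decide
  simp [fractionTerm, this, unitExp_zero]

lemma prod_injOn_primes {P : Finset ℕ} (hP : ∀ p ∈ P, p.Prime) :
    Set.InjOn (fun C : Finset ℕ => ∏ p ∈ C, p) {C | C ⊆ P} := by
  intro C hC D hD h
  simp only at h
  rw [← Nat.primeFactors_prod fun p hp => hP p (hC hp), h,
    Nat.primeFactors_prod fun p hp => hP p (hD hp)]

/-- Cauchy-Schwarz is applied once, over all fractions with these denominators together. The first
factor under the root comes from the x-sums, the second from the large sieve with K = y^j, once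
inverses are removed. -/
lemma sum_norm_fractionTerm_le {P A : Finset ℕ} {inv : ℕ → ℤ} {y N X j : ℕ} (hy : 0 < y)
    (hP : ∀ p ∈ P, p.Prime) (hPy : ∀ p ∈ P, p ≤ y) (hA : A ⊆ range N)
    (hinv : ∀ u ∈ A, ((∏ p ∈ P, p : ℕ) : ℤ) ∣ u * inv u - 1) (hj : 1 ≤ j) :
    ∑ C ∈ P.powersetCard j, ‖fractionTerm A inv X (∏ p ∈ C, p)‖ ≤
      √((((#P).choose j : ℝ) * (y ^ j * X)) *
        ((2 * N + ((y ^ j) ^ 2 : ℕ) * (1 + Real.log ((y ^ j) ^ 2 : ℕ))) * #A)) := by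
  set Q := (P.powersetCard j).image fun C => ∏ p ∈ C, p with hQ
  have hinj : Set.InjOn (fun C : Finset ℕ => ∏ p ∈ C, p) (P.powersetCard j) := by
    intro C hC D hD h
    exact prod_injOn_primes hP (mem_powersetCard.1 hC).1 (mem_powersetCard.1 hD).1 h
  have hQy : ∀ q ∈ Q, q ≤ y ^ j := by
    intro q hq
    obtain ⟨C, hC, rfl⟩ := mem_image.1 hq
    rw [mem_powersetCard] at hC
    rw [← hC.2]
    exact prod_le_pow_card _ _ _ fun p hp => hPy p (hC.1 hp)
  have hQ2 : ∀ q ∈ Q, 2 ≤ q := by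
    intro q hq
    obtain ⟨C, hC, rfl⟩ := mem_image.1 hq
    rw [mem_powersetCard] at hC
    obtain ⟨p, hp⟩ : C.Nonempty := card_pos.1 (by omega)
    refine (hP p (hC.1 hp)).two_le.trans (Nat.le_of_dvd ?_ (dvd_prod_of_mem _ hp))
    exact prod_pos fun p hp => (hP p (hC.1 hp)).pos
  have hQd : ∀ q ∈ Q, q ∣ ∏ p ∈ P, p := by
    intro q hq
    obtain ⟨C, hC, rfl⟩ := mem_image.1 hq
    exact prod_dvd_prod_of_subset _ _ _ (mem_powersetCard.1 hC).1
  have hcard : #Q = (#P).choose j := by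
    rw [hQ, card_image_of_injOn hinj, card_powersetCard]
  rw [← sum_image (f := fun q => ‖fractionTerm A inv X q‖) hinj]
  apply Real.le_sqrt_of_sq_le
  have h1 : ∑ q ∈ Q, ‖fractionTerm A inv X q‖ ≤ ∑ w ∈ Q.sigma reducedResidues,
      ‖∑ x ∈ Icc 1 X, unitExp ((w.2 : ℝ) / w.1 * (x : ℤ))‖ *
        ‖∑ u ∈ A, unitExp ((w.2 : ℝ) / w.1 * (-inv u : ℤ))‖ := by
    rw [sum_sigma]
    refine sum_le_sum fun q _ => (norm_sum_le _ _).trans (sum_le_sum fun h _ => ?_)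
    rw [norm_mul]
  have h2 : ∑ w ∈ Q.sigma reducedResidues,
      ‖∑ x ∈ Icc 1 X, unitExp ((w.2 : ℝ) / w.1 * (x : ℤ))‖ ^ 2 ≤
        ((#P).choose j : ℝ) * (y ^ j * X) := by
    rw [sum_sigma, ← hcard, ← nsmul_eq_mul]
    refine sum_le_card_nsmul _ _ _ fun q hq => (sum_norm_sq_interval_le (hQ2 q hq) X).trans ?_
    gcongr
    exact_mod_cast hQy q hq
  have h3 : ∑ w ∈ Q.sigma reducedResidues,
      ‖∑ u ∈ A, unitExp ((w.2 : ℝ) / w.1 * (-inv u : ℤ))‖ ^ 2 ≤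
        (2 * N + ((y ^ j) ^ 2 : ℕ) * (1 + Real.log ((y ^ j) ^ 2 : ℕ))) * #A := by
    rw [sum_sigma]
    refine le_trans (le_of_eq ?_) (large_sieve_fractions (K := y ^ j) (by positivity) hQy hA)
    refine sum_congr rfl fun q hq => sum_norm_sq_inverse fun u hu => ?_
    exact (Int.natCast_dvd_natCast.2 (hQd q hq)).trans (hinv u hu)
  calc _ ≤ (∑ w ∈ Q.sigma reducedResidues,
      ‖∑ x ∈ Icc 1 X, unitExp ((w.2 : ℝ) / w.1 * (x : ℤ))‖ *
        ‖∑ u ∈ A, unitExp ((w.2 : ℝ) / w.1 * (-inv u : ℤ))‖) ^ 2 := by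
        gcongr
    _ ≤ _ := sum_mul_sq_le_sq_mul_sq _ _ _
    _ ≤ _ := by gcongr

/-- The equation `u * x ≡ 1` modulo `v` has, on average over the products `v` of `m` primes of a
given set, about the expected number of solutions. -/
theorem abs_sum_mul_card_inversePairs_sub_le {P A : Finset ℕ} {inv : ℕ → ℤ} {y N X m : ℕ}
    (hy : 0 < y) (hP : ∀ p ∈ P, p.Prime) (hPy : ∀ p ∈ P, p ≤ y) (hA : A ⊆ range N)
    (hinv : ∀ u ∈ A, ((∏ p ∈ P, p : ℕ) : ℤ) ∣ u * inv u - 1) :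
    |∑ B ∈ P.powersetCard m, ((∏ p ∈ B, p : ℕ) : ℝ) * #(inversePairs A X (∏ p ∈ B, p)) -
        (#P).choose m * (X * #A)| ≤
      ∑ j ∈ Icc 1 m, ((#P - j).choose (m - j) : ℝ) *
        √((((#P).choose j : ℝ) * (y ^ j * X)) *
          ((2 * N + ((y ^ j) ^ 2 : ℕ) * (1 + Real.log ((y ^ j) ^ 2 : ℕ))) * #A)) := by
  set G : Finset ℕ → ℂ := fun C => fractionTerm A inv X (∏ p ∈ C, p) with hG
  have h1 : ((∑ B ∈ P.powersetCard m, ((∏ p ∈ B, p : ℕ) : ℝ) *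
      #(inversePairs A X (∏ p ∈ B, p)) : ℝ) : ℂ) =
      ∑ j ∈ range (m + 1), ∑ C ∈ P.powersetCard j,
        (#{B ∈ P.powersetCard m | C ⊆ B} : ℂ) * G C := by
    have h2 : ∀ B ∈ P.powersetCard m, ((∏ p ∈ B, p : ℕ) : ℂ) *
        #(inversePairs A X (∏ p ∈ B, p)) = ∑ j ∈ range (m + 1), ∑ C ∈ B.powersetCard j, G C := by
      intro B hB
      rw [mem_powersetCard] at hB
      have hBp : ∀ p ∈ B, p.Prime := fun p hp => hP p (hB.1 hp)
      rw [mul_card_inversePairs (prod_ne_zero_iff.2 fun p hp => (hBp p hp).ne_zero)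
        (fun u hu => (Int.natCast_dvd_natCast.2 (prod_dvd_prod_of_subset _ _ _ hB.1)).trans
          (hinv u hu)), sum_divisors_prod_primes hBp, sum_powerset, hB.2]
    rw [Complex.ofReal_sum]
    simp_rw [Complex.ofReal_mul, Complex.ofReal_natCast]
    rw [sum_congr rfl h2, sum_comm]
    refine sum_congr rfl fun j _ => ?_
    rw [sum_comm' (t' := P.powersetCard j) (s' := fun C => {B ∈ P.powersetCard m | C ⊆ B})]
    · simp
    · intro B C
      simp only [mem_powersetCard, mem_filter]
      constructor
      · rintro ⟨⟨a, b⟩, c, d⟩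
        exact ⟨⟨⟨a, b⟩, c⟩, c.trans a, d⟩
      · rintro ⟨⟨⟨a, b⟩, c⟩, -, d⟩
        exact ⟨⟨a, b⟩, c, d⟩
  have h3 : ((∑ B ∈ P.powersetCard m, ((∏ p ∈ B, p : ℕ) : ℝ) *
      #(inversePairs A X (∏ p ∈ B, p)) - (#P).choose m * (X * #A) : ℝ) : ℂ) =
      ∑ j ∈ Icc 1 m, ∑ C ∈ P.powersetCard j,
        (#{B ∈ P.powersetCard m | C ⊆ B} : ℂ) * G C := by
    -- The term j = 0 has only C = ∅, so q = 1: it is the main term and cancels.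
    rw [Complex.ofReal_sub, h1, Finset.range_eq_Ico, sum_eq_sum_Ico_succ_bot (Nat.succ_pos m)]
    have : (Ico (0 + 1) (m + 1)) = Icc 1 m := by ext; simp
    rw [this]
    simp [hG, fractionTerm_one]
  rw [← Real.norm_eq_abs, ← Complex.norm_real, h3]
  refine (norm_sum_le _ _).trans (sum_le_sum fun j hj => (norm_sum_le _ _).trans ?_)
  calc _ ≤ ∑ C ∈ P.powersetCard j, ((#P - j).choose (m - j) : ℝ) * ‖G C‖ := by
        refine sum_le_sum fun C hC => ?_
        rw [mem_powersetCard] at hC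
        rw [norm_mul, Complex.norm_natCast]
        gcongr
        have := card_filter_subset_le hC.1 m
        rwa [hC.2] at this
    _ ≤ _ := by
        rw [← mul_sum]
        gcongr
        exact sum_norm_fractionTerm_le hy hP hPy hA hinv (mem_Icc.1 hj).1

/-! ### Choice of parameters and size of the error -/

lemma pow_le_choose_of_mul_le {g k r : ℕ} (h : r * (g + 1) ≤ k) : g ^ r ≤ k.choose r := by
  rcases Nat.eq_zero_or_pos r with rfl | hr
  · simp
  have h1 : ((k + 1 - r : ℕ) ^ r : ℚ) ≤ r.factorial * k.choose r := by
    have := Nat.pow_le_choose (α := ℚ) r k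
    rwa [div_le_iff₀' (by positivity)] at this
  have h2 : (k + 1 - r) ^ r ≤ r.factorial * k.choose r := by exact_mod_cast h1
  have h3 : (r * g) ^ r ≤ r ^ r * k.choose r := by
    calc (r * g) ^ r ≤ (k + 1 - r) ^ r := by
          gcongr
          rw [mul_add] at h
          omega
      _ ≤ _ := h2
      _ ≤ _ := by gcongr; exact Nat.factorial_le_pow r
  rw [mul_pow] at h3
  exact Nat.le_of_mul_le_mul_left h3 (by positivity)

lemma two_mul_add_two_le_pow {a T : ℕ} (ha : 1 ≤ a) (hT : 4 ≤ T) : 2 * a + 2 ≤ T ^ a := by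
  induction a, ha using Nat.le_induction with
  | base => simpa using hT
  | succ n hn ih =>
    rw [pow_succ]
    nlinarith

/-- Criterion for one j to contribute at most 1 / (2m) of the main term, so that all m of them take
at most half. -/
lemma mul_sqrt_le_of_mul_le {A c n M Y X L u m : ℝ} (hA : 0 ≤ A) (hc : 0 < c) (hn : 0 ≤ n)
    (hX : 0 ≤ X) (hY : 0 ≤ Y) (hL : 0 ≤ L) (hu : 0 ≤ u) (hm : 0 < m) (hAc : A * c ≤ n * M)
    (h : 4 * m ^ 2 * M ^ 2 * Y * L ≤ c * u * X) :
    A * √((c * (Y * X)) * (L * u)) ≤ n * (X * u) / (2 * m) := by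
  rw [le_div_iff₀ (by positivity)]
  refine le_of_sq_le_sq ?_ (by positivity)
  rw [mul_pow, mul_pow, Real.sq_sqrt (by positivity)]
  refine le_of_mul_le_mul_right ?_ hc
  calc _ = (A * c) ^ 2 * (4 * m ^ 2 * Y * X * L * u) := by ring
    _ ≤ (n * M) ^ 2 * (4 * m ^ 2 * Y * X * L * u) := by gcongr
    _ = (n ^ 2 * X * u) * (4 * m ^ 2 * M ^ 2 * Y * L) := by ring
    _ ≤ (n ^ 2 * X * u) * (c * u * X) := by gcongr
    _ = _ := by ring

/-- Both the interval length and K² are about y^(2m) at most; one further factor T^m absorbs the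
logarithm and the constants. -/
lemma large_sieve_factor_le {a T j : ℕ} (ha : 1 ≤ a) (hT : 12 * a + 48 ≤ T) (hj : j ≤ T ^ a) :
    (2 * (((T ^ (6 * a + 18)) ^ (2 * T ^ a) + 1 : ℕ) : ℝ) +
      (((T ^ (6 * a + 18)) ^ j) ^ 2 : ℕ) *
        (1 + Real.log (((T ^ (6 * a + 18)) ^ j) ^ 2 : ℕ))) ≤
      (T : ℝ) ^ ((12 * a + 37) * T ^ a) := by
  set m := T ^ a with hm
  set Y : ℕ := (T ^ (6 * a + 18)) ^ (2 * m) with hY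
  have hT0 : 0 < T := by omega
  have hY0 : 1 ≤ Y := Nat.one_le_iff_ne_zero.2 (by positivity)
  have hK : ((T ^ (6 * a + 18)) ^ j) ^ 2 ≤ Y := by
    rw [hY, ← pow_mul _ j 2]
    exact Nat.pow_le_pow_right (by positivity) (by omega)
  have hK0 : 0 < ((T ^ (6 * a + 18)) ^ j) ^ 2 := by positivity
  set K2 := ((T ^ (6 * a + 18)) ^ j) ^ 2
  have hlog : Real.log (K2 : ℕ) ≤ m * T ^ 2 := by
    have h1 : Real.log (K2 : ℕ) ≤ Real.log (Y : ℕ) :=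
      Real.log_le_log (by exact_mod_cast hK0) (by exact_mod_cast hK)
    have h2 : Real.log (Y : ℕ) = (6 * a + 18) * (2 * m) * Real.log T := by
      rw [hY]; push_cast
      rw [← pow_mul, Real.log_pow]; push_cast; ring
    have h3 : Real.log T ≤ T := by
      have := Real.log_le_sub_one_of_pos (show (0 : ℝ) < T by exact_mod_cast hT0)
      linarith
    have h4 : ((6 * a + 18) * 2 : ℝ) ≤ T := by
      have : (6 * a + 18) * 2 ≤ T := by omega
      exact_mod_cast this
    calc Real.log (K2 : ℕ) ≤ (6 * a + 18) * (2 * m) * Real.log T := h1.trans h2.le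
      _ ≤ (6 * a + 18) * (2 * m) * T := by gcongr
      _ = ((6 * a + 18) * 2) * (m * T) := by ring
      _ ≤ T * (m * T) := by gcongr
      _ = _ := by ring
  have hsmall : 5 + m * T ^ 2 ≤ T ^ m := by
    have h1 : a + 3 ≤ m := by
      have := two_mul_add_two_le_pow ha (show 4 ≤ T by omega)
      omega
    calc 5 + m * T ^ 2 = 5 + T ^ (a + 2) := by rw [hm, pow_add]
      _ ≤ T * T ^ (a + 2) := by
        have : T ≤ T ^ (a + 2) := Nat.le_self_pow (by omega) T
        nlinarith
      _ = T ^ (a + 3) := by ring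
      _ ≤ T ^ m := Nat.pow_le_pow_right hT0 h1
  have hfin : (T : ℝ) ^ ((12 * a + 37) * m) = Y * (T ^ m : ℕ) := by
    rw [hY]; push_cast
    rw [← pow_mul, ← pow_add]
    congr 1
    ring
  rw [hfin]
  have hY1 : (1 : ℝ) ≤ Y := by exact_mod_cast hY0
  calc _ ≤ 2 * ((Y : ℝ) + 1) + Y * (1 + m * T ^ 2) := by
        push_cast
        gcongr
    _ ≤ Y * ((5 + m * T ^ 2 : ℕ) : ℝ) := by push_cast; nlinarith
    _ ≤ _ := by gcongr

lemma sum_error_le {a T n : ℕ} (ha : 1 ≤ a) (hT : 12 * a + 48 ≤ T)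
    (hn : (T ^ (5 * a + 16)) ^ (2 * T ^ a) ≤ n) :
    ∑ j ∈ Icc 1 (T ^ a), ((T ^ (6 * a + 17) - j).choose (T ^ a - j) : ℝ) *
        √((((T ^ (6 * a + 17)).choose j : ℝ) *
            ((T ^ (6 * a + 18) : ℕ) ^ j * (T ^ ((3 * a + 9) * T ^ a) : ℕ))) *
          ((2 * (((T ^ (6 * a + 18)) ^ (2 * T ^ a) + 1 : ℕ) : ℝ) +
            (((T ^ (6 * a + 18)) ^ j) ^ 2 : ℕ) *
              (1 + Real.log (((T ^ (6 * a + 18)) ^ j) ^ 2 : ℕ))) * n)) ≤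
      (T ^ (6 * a + 17)).choose (T ^ a) * ((T ^ ((3 * a + 9) * T ^ a) : ℕ) * (n : ℝ)) / 2 := by
  have hT0 : 0 < T := by omega
  have hT1 : (1 : ℝ) ≤ T := by exact_mod_cast hT0
  set m := T ^ a with hm
  have hm0 : 0 < m := by positivity
  have hgk : ∀ r ≤ m, (T ^ (5 * a + 16)) ^ r ≤ (T ^ (6 * a + 17)).choose r := by
    intro r hr
    apply pow_le_choose_of_mul_le
    calc r * (T ^ (5 * a + 16) + 1) ≤ m * (T ^ (5 * a + 16) + T ^ (5 * a + 16)) := by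
          gcongr
          exact Nat.one_le_pow _ _ hT0
      _ = 2 * T ^ (6 * a + 16) := by rw [hm]; ring
      _ ≤ T * T ^ (6 * a + 16) := by gcongr; omega
      _ = _ := by ring
  have hterm : ∀ j ∈ Icc 1 m, ((T ^ (6 * a + 17) - j).choose (m - j) : ℝ) *
        √((((T ^ (6 * a + 17)).choose j : ℝ) *
            ((T ^ (6 * a + 18) : ℕ) ^ j * (T ^ ((3 * a + 9) * m) : ℕ))) *
          ((2 * (((T ^ (6 * a + 18)) ^ (2 * m) + 1 : ℕ) : ℝ) +
            (((T ^ (6 * a + 18)) ^ j) ^ 2 : ℕ) *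
              (1 + Real.log (((T ^ (6 * a + 18)) ^ j) ^ 2 : ℕ))) * n)) ≤
      (T ^ (6 * a + 17)).choose m * ((T ^ ((3 * a + 9) * m) : ℕ) * (n : ℝ)) / (2 * m) := by
    intro j hj
    rw [mem_Icc] at hj
    have hlog : 0 ≤ Real.log (((T ^ (6 * a + 18)) ^ j) ^ 2 : ℕ) := Real.log_natCast_nonneg _
    have hc0 : (0 : ℝ) < (T ^ (6 * a + 17)).choose j := by
      have := (show 0 < (T ^ (5 * a + 16)) ^ j by positivity).trans_le (hgk j hj.2)
      exact_mod_cast this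
    refine mul_sqrt_le_of_mul_le (M := 2 ^ m) (by positivity) hc0 (by positivity) (by positivity)
      (by positivity) (by positivity) (by positivity) (by exact_mod_cast hm0) ?_ ?_
    · have h := Nat.choose_mul (n := T ^ (6 * a + 17)) hj.2
      have h2 : m.choose j ≤ 2 ^ m := Nat.choose_le_two_pow m j
      have h3 : (T ^ (6 * a + 17) - j).choose (m - j) * (T ^ (6 * a + 17)).choose j ≤
          (T ^ (6 * a + 17)).choose m * 2 ^ m := by
        rw [mul_comm, ← h]
        gcongr
      exact_mod_cast h3
    · have h1 : (4 * m ^ 2 : ℝ) ≤ T ^ m := by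
        have : 4 * m ^ 2 ≤ T ^ m := by
          have h1 : 2 * a + 1 ≤ m := by
            have := two_mul_add_two_le_pow ha (show 4 ≤ T by omega)
            omega
          calc 4 * m ^ 2 = 4 * T ^ (2 * a) := by rw [hm]; ring
            _ ≤ T * T ^ (2 * a) := by gcongr; omega
            _ = T ^ (2 * a + 1) := by ring
            _ ≤ _ := Nat.pow_le_pow_right hT0 h1
        exact_mod_cast this
      have h2 : ((2 ^ m) ^ 2 : ℝ) ≤ T ^ m := by
        rw [← pow_mul, mul_comm, pow_mul]
        gcongr
        have : 4 ≤ T := by omega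
        norm_num
        exact_mod_cast this
      have h3 := large_sieve_factor_le ha hT hj.2
      have h4 : (T : ℝ) ^ ((5 * a + 16) * j) ≤ (T ^ (6 * a + 17)).choose j := by
        rw [pow_mul]; exact_mod_cast hgk j hj.2
      have h5 : (T : ℝ) ^ ((5 * a + 16) * (2 * m)) ≤ n := by
        rw [pow_mul]; exact_mod_cast hn
      calc _ ≤ (T : ℝ) ^ m * T ^ m * (T ^ (6 * a + 18) : ℕ) ^ j * T ^ ((12 * a + 37) * m) := by
            gcongr
        _ = (T : ℝ) ^ (m + m + (6 * a + 18) * j + (12 * a + 37) * m) := by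
            push_cast
            rw [← pow_mul]; ring
        -- The exponents compare as (a + 2) j ≤ (a + 2) m, with equality at j = m: this fixes the
        -- exponent 3a + 9 of X.
        _ ≤ (T : ℝ) ^ ((5 * a + 16) * j + (5 * a + 16) * (2 * m) + (3 * a + 9) * m) := by
            apply pow_le_pow_right₀ hT1
            nlinarith [Nat.mul_le_mul_left (a + 2) hj.2]
        _ = (T : ℝ) ^ ((5 * a + 16) * j) * T ^ ((5 * a + 16) * (2 * m)) *
              (T ^ ((3 * a + 9) * m) : ℕ) := by
            push_cast
            rw [pow_add, pow_add]
        _ ≤ _ := by gcongr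
  refine (sum_le_sum hterm).trans (le_of_eq ?_)
  have : (m : ℝ) ≠ 0 := by positivity
  rw [sum_const, Nat.card_Icc, nsmul_eq_mul]
  simp only [Nat.add_sub_cancel]
  field_simp

/-! ### Counting triples and the pigeonhole -/

lemma exists_inverses {A : Finset ℕ} {M : ℕ} (h : ∀ u ∈ A, u.Coprime M) :
    ∃ inv : ℕ → ℤ, ∀ u ∈ A, (M : ℤ) ∣ u * inv u - 1 := by
  have h1 : ∀ u : ℕ, ∃ i : ℤ, u ∈ A → (M : ℤ) ∣ u * i - 1 := by
    intro u
    by_cases hu : u ∈ A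
    · obtain ⟨i, hi⟩ := Int.mod_coprime (h u hu)
      exact ⟨i, fun _ => hi.symm.dvd⟩
    · exact ⟨0, fun h => absurd h hu⟩
  choose inv hinv using h1
  exact ⟨inv, hinv⟩

/-- The products of `n` primes of a given set. -/
def primeProducts (P : Finset ℕ) (n : ℕ) : Finset ℕ :=
  (P.powersetCard n).image fun C => ∏ p ∈ C, p

lemma card_primeProducts {P : Finset ℕ} (hP : ∀ p ∈ P, p.Prime) (n : ℕ) :
    #(primeProducts P n) = (#P).choose n := by
  rw [primeProducts, card_image_of_injOn, card_powersetCard]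
  intro C hC D hD h
  exact prod_injOn_primes hP (mem_powersetCard.1 hC).1 (mem_powersetCard.1 hD).1 h

/-- The solutions `(u, x)` of `u * x ≡ 1` modulo `v`, together with the set of primes composing
`v`. -/
def congruenceSolutions (P A : Finset ℕ) (X m : ℕ) : Finset ((_ : Finset ℕ) × ℕ × ℕ) :=
  (P.powersetCard m).sigma fun B => inversePairs A X (∏ p ∈ B, p)

lemma mem_congruenceSolutions {P A : Finset ℕ} {X m : ℕ} {s : (_ : Finset ℕ) × ℕ × ℕ} :
    s ∈ congruenceSolutions P A X m ↔ (s.1 ⊆ P ∧ #s.1 = m) ∧ (s.2.1 ∈ A ∧ 1 ≤ s.2.2 ∧ s.2.2 ≤ X) ∧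
      ((∏ p ∈ s.1, p : ℕ) : ℤ) ∣ (s.2.1 : ℤ) * s.2.2 - 1 := by
  simp [congruenceSolutions, inversePairs, mem_powersetCard, and_assoc]

lemma card_congruenceSolutions {a T : ℕ} (ha : 1 ≤ a) (hT : 12 * a + 48 ≤ T) {P₁ P₂ : Finset ℕ}
    (hdisj : Disjoint P₁ P₂) (hP₁ : ∀ p ∈ P₁, p.Prime) (hP₂ : ∀ p ∈ P₂, p.Prime)
    (hP₁y : ∀ p ∈ P₁, p ≤ T ^ (6 * a + 18)) (hP₂y : ∀ p ∈ P₂, p ≤ T ^ (6 * a + 18))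
    (hc₁ : #P₁ = T ^ (6 * a + 17)) (hc₂ : #P₂ = T ^ (6 * a + 17)) :
    T ^ ((3 * a + 9) * T ^ a) * T ^ ((9 * a + 28) * T ^ a) * T ^ T ^ a ≤
      #(congruenceSolutions P₂ (primeProducts P₁ (2 * T ^ a)) (T ^ ((3 * a + 9) * T ^ a))
        (T ^ a)) := by
  have hT0 : 0 < T := by omega
  set m := T ^ a with hm
  have hm0 : 0 < m := by positivity
  set A := primeProducts P₁ (2 * m) with hA
  set X := T ^ ((3 * a + 9) * m) with hX
  set y := T ^ (6 * a + 18) with hy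
  have hgk : ∀ r ≤ 2 * m, (T ^ (5 * a + 16)) ^ r ≤ (T ^ (6 * a + 17)).choose r := by
    intro r hr
    apply pow_le_choose_of_mul_le
    calc r * (T ^ (5 * a + 16) + 1) ≤ (2 * m) * (T ^ (5 * a + 16) + T ^ (5 * a + 16)) := by
          gcongr
          exact Nat.one_le_pow _ _ hT0
      _ = 4 * T ^ (6 * a + 16) := by rw [hm]; ring
      _ ≤ T * T ^ (6 * a + 16) := by gcongr; omega
      _ = _ := by ring
  have hcA : #A = (T ^ (6 * a + 17)).choose (2 * m) := by
    rw [hA, card_primeProducts hP₁, hc₁]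
  have hnA : (T ^ (5 * a + 16)) ^ (2 * m) ≤ #A := hcA ▸ hgk _ le_rfl
  have hAr : A ⊆ range (y ^ (2 * m) + 1) := by
    intro u hu
    obtain ⟨C, hC, rfl⟩ := mem_image.1 hu
    rw [mem_powersetCard] at hC
    rw [mem_range, Nat.lt_succ_iff, ← hC.2]
    exact prod_le_pow_card _ _ _ fun p hp => hP₁y p (hC.1 hp)
  obtain ⟨inv, hinv⟩ : ∃ inv : ℕ → ℤ, ∀ u ∈ A, ((∏ p ∈ P₂, p : ℕ) : ℤ) ∣ u * inv u - 1 := by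
    apply exists_inverses
    intro u hu
    obtain ⟨C, hC, rfl⟩ := mem_image.1 hu
    rw [mem_powersetCard] at hC
    refine Nat.Coprime.prod_left fun p hp => Nat.Coprime.prod_right fun q hq => ?_
    refine (Nat.coprime_primes (hP₁ p (hC.1 hp)) (hP₂ q hq)).2 ?_
    rintro rfl
    exact disjoint_left.1 hdisj (hC.1 hp) hq
  have hmain := abs_sum_mul_card_inversePairs_sub_le (m := m) (X := X) (y := y) (by positivity)
    hP₂ hP₂y hAr hinv
  rw [hc₂] at hmain
  have hmain2 := hmain.trans (sum_error_le ha hT hnA)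
  have h1 : (∑ B ∈ P₂.powersetCard m, ((∏ p ∈ B, p : ℕ) : ℝ) *
      #(inversePairs A X (∏ p ∈ B, p))) ≤
      (y : ℝ) ^ m * #(congruenceSolutions P₂ A X m) := by
    rw [congruenceSolutions, card_sigma]
    rw [Nat.cast_sum, mul_sum]
    refine sum_le_sum fun B hB => ?_
    rw [mem_powersetCard] at hB
    have h := prod_le_pow_card B (fun p => p) y fun p hp => hP₂y p (hB.1 hp)
    rw [hB.2] at h
    gcongr
    exact (Nat.cast_le.2 h).trans (Nat.cast_pow y m).le
  have h2 : ((T ^ (6 * a + 17)).choose m * (X * (#A : ℝ))) / 2 ≤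
      (y : ℝ) ^ m * #(congruenceSolutions P₂ A X m) := by
    have := (abs_le.1 hmain2).1
    linarith
  have h3 : (T ^ (6 * a + 17)).choose m * (X * #A) ≤
      2 * (y ^ m * #(congruenceSolutions P₂ A X m)) := by
    have : ((T ^ (6 * a + 17)).choose m * (X * (#A : ℝ))) ≤
      2 * ((y : ℝ) ^ m * #(congruenceSolutions P₂ A X m)) := by linarith
    exact_mod_cast this
  have h4 : y ^ m * (2 * (X * T ^ ((9 * a + 28) * m) * T ^ m)) ≤
      y ^ m * (2 * #(congruenceSolutions P₂ A X m)) := by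
    calc y ^ m * (2 * (X * T ^ ((9 * a + 28) * m) * T ^ m))
        = 2 * T ^ ((6 * a + 18) * m + (3 * a + 9) * m + (9 * a + 28) * m + m) := by
          rw [hy, hX, ← pow_mul]; ring
      _ ≤ T ^ m * T ^ ((6 * a + 18) * m + (3 * a + 9) * m + (9 * a + 28) * m + m) := by
          gcongr
          exact (by omega : 2 ≤ T).trans (Nat.le_self_pow hm0.ne' T)
      _ = T ^ (m + ((6 * a + 18) * m + (3 * a + 9) * m + (9 * a + 28) * m + m)) := by
          rw [pow_add T m]
      -- Both exponents equal (18a + 57) m.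
      _ ≤ T ^ ((5 * a + 16) * m + (3 * a + 9) * m + (5 * a + 16) * (2 * m)) := by
          apply Nat.pow_le_pow_right hT0
          nlinarith
      _ = (T ^ (5 * a + 16)) ^ m * (X * (T ^ (5 * a + 16)) ^ (2 * m)) := by
          rw [hX, ← pow_mul, ← pow_mul]; ring
      _ ≤ (T ^ (6 * a + 17)).choose m * (X * #A) := by
          gcongr
          exact hgk m (by omega)
      _ ≤ _ := h3.trans (le_of_eq (by ring))
  have h5 := Nat.le_of_mul_le_mul_left h4 (by positivity)
  omega

theorem exists_many_sUnitSolutions {a T : ℕ} (ha : 1 ≤ a) (hT : 12 * a + 48 ≤ T)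
    {P₁ P₂ : Finset ℕ} (hdisj : Disjoint P₁ P₂) (hP₁ : ∀ p ∈ P₁, p.Prime)
    (hP₂ : ∀ p ∈ P₂, p.Prime) (hP₁y : ∀ p ∈ P₁, p ≤ T ^ (6 * a + 18))
    (hP₂y : ∀ p ∈ P₂, p ≤ T ^ (6 * a + 18)) (hP₂w : ∀ p ∈ P₂, T ^ (6 * a + 17) ≤ p)
    (hc₁ : #P₁ = T ^ (6 * a + 17)) (hc₂ : #P₂ = T ^ (6 * a + 17)) :
    ∃ x z : ℕ, 0 < x ∧ x ≤ T ^ ((3 * a + 9) * T ^ a) ∧ 0 < z ∧ z ≤ T ^ ((9 * a + 28) * T ^ a) ∧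
      ((T ^ T ^ a : ℕ) : ℕ∞) ≤ (sUnitSolutions
        (Nat.primesLE (T ^ (6 * a + 18)) ∪ (x.primeFactors ∪ z.primeFactors))).encard := by
  have hT0 : 0 < T := by omega
  set m := T ^ a with hm
  have hm0 : 0 < m := by positivity
  set A := primeProducts P₁ (2 * m) with hA
  set X := T ^ ((3 * a + 9) * m) with hX
  set y := T ^ (6 * a + 18) with hy
  set Z := T ^ ((9 * a + 28) * m) with hZ
  have hcard := card_congruenceSolutions ha hT hdisj hP₁ hP₂ hP₁y hP₂y hc₁ hc₂
  set Sol := congruenceSolutions P₂ A X m with hSol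
  have hA2 : ∀ u ∈ A, 2 ≤ u := by
    intro u hu
    obtain ⟨C, hC, rfl⟩ := mem_image.1 hu
    rw [mem_powersetCard] at hC
    obtain ⟨p, hp⟩ : C.Nonempty := card_pos.1 (by omega)
    refine (hP₁ p (hC.1 hp)).two_le.trans (Nat.le_of_dvd ?_ (dvd_prod_of_mem _ hp))
    exact prod_pos fun p hp => (hP₁ p (hC.1 hp)).pos
  have hAU : ∀ u ∈ A, u ≤ y ^ (2 * m) := by
    intro u hu
    obtain ⟨C, hC, rfl⟩ := mem_image.1 hu
    rw [mem_powersetCard] at hC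
    rw [← hC.2]
    exact prod_le_pow_card _ _ _ fun p hp => hP₁y p (hC.1 hp)
  have hAp : ∀ u ∈ A, ∀ p : ℕ, p.Prime → p ∣ u → p ≤ y := by
    intro u hu p hp hpu
    obtain ⟨C, hC, rfl⟩ := mem_image.1 hu
    rw [mem_powersetCard] at hC
    obtain ⟨q, hq, hpq⟩ := (Prime.dvd_finsetProd_iff hp.prime _).1 hpu
    rw [(Nat.prime_dvd_prime_iff_eq hp (hP₁ q (hC.1 hq))).1 hpq]
    exact hP₁y q (hC.1 hq)
  set f : ((_ : Finset ℕ) × ℕ × ℕ) → ℕ × ℕ :=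
    fun s => (s.2.2, (s.2.1 * s.2.2 - 1) / ∏ p ∈ s.1, p) with hf
  -- The bound ux ≥ 2 makes the natural subtraction exact and z positive.
  have hdvd : ∀ s ∈ Sol, (∏ p ∈ s.1, p) ∣ s.2.1 * s.2.2 - 1 ∧ 2 ≤ s.2.1 * s.2.2 := by
    intro s hs
    obtain ⟨-, ⟨hu, hx1, -⟩, hd⟩ := mem_congruenceSolutions.1 hs
    have h2 : 2 * 1 ≤ s.2.1 * s.2.2 := Nat.mul_le_mul (hA2 _ hu) hx1
    refine ⟨?_, h2⟩
    have : (((s.2.1 * s.2.2 - 1 : ℕ)) : ℤ) = (s.2.1 : ℤ) * s.2.2 - 1 := by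
      rw [Nat.cast_sub (by omega)]; push_cast; ring
    rw [← this] at hd
    exact_mod_cast hd
  have hmaps : ∀ s ∈ Sol, f s ∈ Icc 1 X ×ˢ Icc 1 Z := by
    intro s hs
    obtain ⟨hd, h2⟩ := hdvd s hs
    obtain ⟨⟨hB, hBm⟩, ⟨hu, hx1, hxX⟩, -⟩ := mem_congruenceSolutions.1 hs
    have hv0 : 0 < ∏ p ∈ s.1, p := prod_pos fun p hp => (hP₂ p (hB hp)).pos
    rw [mem_product, mem_Icc, mem_Icc]
    refine ⟨⟨hx1, hxX⟩, Nat.div_pos (Nat.le_of_dvd (by omega) hd) hv0, ?_⟩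
    have hvw : (T ^ (6 * a + 17)) ^ m ≤ ∏ p ∈ s.1, p := by
      rw [← hBm]
      exact pow_card_le_prod _ _ _ fun p hp => hP₂w p (hB hp)
    refine Nat.div_le_of_le_mul ?_
    calc s.2.1 * s.2.2 - 1 ≤ s.2.1 * s.2.2 := Nat.sub_le _ _
      _ ≤ y ^ (2 * m) * X := Nat.mul_le_mul (hAU _ hu) hxX
      _ = (T ^ (6 * a + 17)) ^ m * Z := by
          rw [hy, hX, hZ, ← pow_mul, ← pow_mul, ← pow_add, ← pow_add]
          congr 1
          ring
      _ ≤ _ := Nat.mul_le_mul_right _ hvw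
  have hX0 : 0 < X := by positivity
  have hZ0 : 0 < Z := by positivity
  -- At least X Z T^m triples fall on at most X Z pairs (x, z).
  obtain ⟨⟨x, z⟩, hxz, hfib⟩ := exists_le_card_fiber_of_mul_le_card_of_maps_to (n := T ^ m) hmaps
    ⟨(1, 1), by simp [mem_product]; omega⟩ (by simpa using hcard)
  rw [mem_product, mem_Icc, mem_Icc] at hxz
  obtain ⟨⟨hx0, hxX⟩, hz0, hzZ⟩ := hxz
  refine ⟨x, z, hx0, hxX, hz0, hzZ, ?_⟩
  set F := {s ∈ Sol | f s = (x, z)} with hF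
  have hFs : ∀ s ∈ F, s ∈ Sol ∧ s.2.2 = x ∧ (∏ p ∈ s.1, p) * z + 1 = s.2.1 * x := by
    intro s hs
    rw [hF, mem_filter] at hs
    obtain ⟨hsol, hfs⟩ := hs
    simp only [hf, Prod.mk.injEq] at hfs
    obtain ⟨hd, h2⟩ := hdvd s hsol
    refine ⟨hsol, hfs.1, ?_⟩
    rw [← hfs.2, Nat.mul_div_cancel' hd, ← hfs.1]
    omega
  set g : ((_ : Finset ℕ) × ℕ × ℕ) → ℤ × ℤ :=
    fun s => (((∏ p ∈ s.1, p : ℕ) : ℤ) * z, (s.2.1 : ℤ) * x) with hg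
  have hginj : Set.InjOn g F := by
    rintro ⟨B, u, x₁⟩ hs ⟨B', u', x₂⟩ hs' h
    obtain ⟨hsol, h1, -⟩ := hFs _ hs
    obtain ⟨hsol', h1', -⟩ := hFs _ hs'
    simp only [hg, Prod.mk.injEq] at h h1 h1'
    have hz' : (z : ℤ) ≠ 0 := by exact_mod_cast (by omega : z ≠ 0)
    have hx' : (x : ℤ) ≠ 0 := by exact_mod_cast (by omega : x ≠ 0)
    have hB : B = B' := prod_injOn_primes hP₂ (mem_congruenceSolutions.1 hsol).1.1
      (mem_congruenceSolutions.1 hsol').1.1 (by exact_mod_cast mul_right_cancel₀ hz' h.1)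
    have hu : u = u' := by exact_mod_cast mul_right_cancel₀ hx' h.2
    subst hB hu h1 h1'
    rfl
  have hsub : g '' F ⊆ sUnitSolutions
      (Nat.primesLE y ∪ (x.primeFactors ∪ z.primeFactors)) := by
    rintro _ ⟨s, hs, rfl⟩
    obtain ⟨hsol, h1, h2⟩ := hFs s hs
    obtain ⟨⟨hB, -⟩, ⟨hu, -, -⟩, -⟩ := mem_congruenceSolutions.1 hsol
    refine ⟨by simp only [hg]; exact_mod_cast h2, ?_⟩
    intro p hp hpd
    simp only [hg] at hpd
    have hpd' : p ∣ (∏ p ∈ s.1, p) * z * (s.2.1 * x) := by exact_mod_cast hpd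
    rw [mem_union, mem_union, Nat.mem_primesLE, Nat.mem_primeFactors, Nat.mem_primeFactors]
    rcases hp.dvd_mul.1 hpd' with h | h <;> rcases hp.dvd_mul.1 h with h | h
    · obtain ⟨q, hq, hpq⟩ := (Prime.dvd_finsetProd_iff hp.prime _).1 h
      rw [(Nat.prime_dvd_prime_iff_eq hp (hP₂ q (hB hq))).1 hpq]
      exact Or.inl ⟨hP₂y q (hB hq), hP₂ q (hB hq)⟩
    · exact Or.inr (Or.inr ⟨hp, h, by omega⟩)
    · exact Or.inl ⟨hAp _ hu p hp h, hp⟩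
    · exact Or.inr (Or.inl ⟨hp, h, by omega⟩)
  calc ((T ^ m : ℕ) : ℕ∞) ≤ ((#F : ℕ) : ℕ∞) := by exact_mod_cast hfib
    _ = (F : Set ((_ : Finset ℕ) × ℕ × ℕ)).encard := (Set.encard_coe_eq_coe_finsetCard F).symm
    _ = (g '' F).encard := hginj.encard_image.symm
    _ ≤ _ := Set.encard_le_encard hsub

/-! ### Supply of primes and conclusion -/

/-- Chebyshev's lower bound. With the base a square t², the crude log t ≤ t costs only one of the
two spare factors t. -/
lemma three_mul_le_card_primesLE {t e : ℕ} (ht : 20 * (e + 1) ≤ t) :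
    3 * (t ^ 2) ^ e ≤ #(Nat.primesLE ((t ^ 2) ^ (e + 1))) := by
  have ht0 : 20 ≤ t := by omega
  set w := (t ^ 2) ^ e with hw
  have hw0 : 1 ≤ w := Nat.one_le_pow _ _ (by positivity)
  set n := (t ^ 2) ^ (e + 1) with hn
  have hnw : n = w * t ^ 2 := pow_succ _ _
  have hn2 : 2 ≤ n := by rw [hnw]; nlinarith
  have hn2' : (2 : ℝ) ≤ n := by exact_mod_cast hn2
  have hlog0 : 0 < Real.log n := Real.log_pos (by linarith)
  have hlog : Real.log n ≤ (e + 1) * 2 * t := by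
    have h1 : Real.log n = (e + 1) * 2 * Real.log t := by
      rw [hn]; push_cast
      rw [Real.log_pow, Real.log_pow]; push_cast; ring
    have h2 : Real.log t ≤ t := by
      have := Real.log_le_sub_one_of_pos (show (0 : ℝ) < t by exact_mod_cast (by omega : 0 < t))
      linarith
    rw [h1]
    gcongr
  have hlog1 : Real.log (n + 1) ≤ 2 * Real.log n := by
    have : Real.log (n ^ 2) = 2 * Real.log n := by rw [Real.log_pow]; norm_num
    rw [← this]
    exact Real.log_le_log (by positivity) (by nlinarith)
  have h := Chebyshev.pi_ge n
  rw [div_le_iff₀ hlog0] at h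
  have h2 := Real.log_two_gt_d9
  have hkey : (3 * w + 2 : ℝ) * Real.log n ≤ n * Real.log 2 := by
    have hw1 : (1 : ℝ) ≤ w := by exact_mod_cast hw0
    have ht1 : (20 * (e + 1) : ℝ) ≤ t := by exact_mod_cast ht
    have hnr : (n : ℝ) = w * t ^ 2 := by exact_mod_cast hnw
    calc (3 * w + 2 : ℝ) * Real.log n ≤ (5 * w) * ((e + 1) * 2 * t) := by
          gcongr; linarith
      _ = (20 * (e + 1)) * (w * t) * (1 / 2) := by ring
      _ ≤ t * (w * t) * (1 / 2) := by gcongr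
      _ = n * (1 / 2) := by rw [hnr]; ring
      _ ≤ _ := by gcongr; linarith
  have h3 : (3 * w : ℝ) * Real.log n ≤ (n.primeCounting : ℝ) * Real.log n := by linarith
  rw [Nat.primesLE_card_eq_primeCounting]
  exact_mod_cast le_of_mul_le_mul_right h3 hlog0

lemma exists_disjoint_primes {w y : ℕ} (h : 3 * w ≤ #(Nat.primesLE y)) :
    ∃ P₁ P₂ : Finset ℕ, Disjoint P₁ P₂ ∧ (∀ p ∈ P₁, p.Prime ∧ w ≤ p ∧ p ≤ y) ∧
      (∀ p ∈ P₂, p.Prime ∧ w ≤ p ∧ p ≤ y) ∧ #P₁ = w ∧ #P₂ = w := by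
  set P := Nat.primesLE y \ range w with hP
  have hPc : 2 * w ≤ #P := by
    have := le_card_sdiff (range w) (Nat.primesLE y)
    rw [card_range, ← hP] at this
    omega
  have hPp : ∀ p ∈ P, p.Prime ∧ w ≤ p ∧ p ≤ y := by
    intro p hp
    rw [hP, mem_sdiff, Nat.mem_primesLE, mem_range, not_lt] at hp
    exact ⟨hp.1.2, hp.2, hp.1.1⟩
  obtain ⟨P₁, h1, hc1⟩ := exists_subset_card_eq (s := P) (n := w) (by omega)
  obtain ⟨P₂, h2, hc2⟩ := exists_subset_card_eq (s := P \ P₁) (n := w) (by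
    rw [card_sdiff_of_subset h1]; omega)
  refine ⟨P₁, P₂, ?_, fun p hp => hPp p (h1 hp), fun p hp => hPp p (mem_sdiff.1 (h2 hp)).1,
    hc1, hc2⟩
  exact disjoint_left.2 fun p hp hp' => (mem_sdiff.1 (h2 hp')).2 hp

/-- With ω the number of prime factors, 2^ω ≤ n ≤ T^e ≤ 2^(T e). -/
lemma card_primeFactors_le {n T e : ℕ} (hn : 0 < n) (h : n ≤ T ^ e) :
    #n.primeFactors ≤ T * e := by
  have h1 : 2 ^ #n.primeFactors ≤ n :=
    (pow_card_le_prod _ _ _ fun p hp => (Nat.prime_of_mem_primeFactors hp).two_le).trans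
      (Nat.le_of_dvd hn (Nat.prod_primeFactors_dvd n))
  have h2 : 2 ^ #n.primeFactors ≤ 2 ^ (T * e) := by
    refine (h1.trans h).trans ?_
    rw [pow_mul]
    exact Nat.pow_le_pow_left Nat.lt_two_pow_self.le e
  exact (Nat.pow_le_pow_iff_right (by norm_num)).1 h2

lemma rpow_le_pow_of_le {a T s : ℕ} {ε : ℝ} (ha : 1 ≤ a * ε) (hε : 0 < ε) (hT : 1 ≤ T)
    (hs0 : 1 ≤ s) (hs : s ≤ T ^ (6 * a + 19)) :
    (s : ℝ) ^ ((1 : ℝ) / 6 - ε) ≤ (T : ℝ) ^ a := by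
  have hT1 : (1 : ℝ) ≤ T := by exact_mod_cast hT
  have hs1 : (1 : ℝ) ≤ s := by exact_mod_cast hs0
  rcases le_total ((1 : ℝ) / 6 - ε) 0 with h | h
  · exact (Real.rpow_le_one_of_one_le_of_nonpos hs1 h).trans (one_le_pow₀ hT1)
  · have hs' : (s : ℝ) ≤ (T : ℝ) ^ (6 * a + 19) := by exact_mod_cast hs
    calc (s : ℝ) ^ ((1 : ℝ) / 6 - ε) ≤ ((T : ℝ) ^ (6 * a + 19)) ^ ((1 : ℝ) / 6 - ε) :=
          Real.rpow_le_rpow (by linarith) hs' h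
      _ = (T : ℝ) ^ (((6 * a + 19 : ℕ) : ℝ) * ((1 : ℝ) / 6 - ε)) := by
          rw [Real.rpow_mul (by linarith), Real.rpow_natCast]
      _ ≤ (T : ℝ) ^ (a : ℝ) := by
          apply Real.rpow_le_rpow_of_exponent_le hT1
          push_cast
          -- Here (6a + 19)(1/6 - ε) ≤ a, because 6aε ≥ 6 exceeds 19/6.
          nlinarith
      _ = _ := Real.rpow_natCast _ _

theorem theorem1 (ε : ℝ) (hε : 0 < ε) :
    ∀ N : ℕ, ∃ S : Finset ℕ, (∀ p ∈ S, p.Prime) ∧ N ≤ S.card ∧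
      ENNReal.ofReal (Real.exp ((S.card : ℝ) ^ ((1 : ℝ) / 6 - ε))) ≤
        (((sUnitSolutions S).encard : ℕ∞) : ENNReal) := by
  intro N
  obtain ⟨a, ha⟩ := exists_nat_ge (1 / ε)
  have ha1 : 1 ≤ a := by
    have : (0 : ℝ) < a := (by positivity : 0 < 1 / ε).trans_le ha
    exact_mod_cast this
  rw [div_le_iff₀ hε] at ha
  -- The first summand serves the prime count; N ensures N ≤ t ≤ T ≤ #S.
  obtain ⟨t, ht⟩ : ∃ t, t = 20 * (6 * a + 17 + 1) + N := ⟨_, rfl⟩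
  obtain ⟨T, hTt⟩ : ∃ T, T = t ^ 2 := ⟨_, rfl⟩
  have htT : t ≤ T := hTt ▸ Nat.le_self_pow (by norm_num) t
  have hT : 12 * a + 48 ≤ T := by omega
  have hT0 : 0 < T := by omega
  have hprimes : 3 * T ^ (6 * a + 17) ≤ #(Nat.primesLE (T ^ (6 * a + 18))) := by
    rw [hTt]
    exact three_mul_le_card_primesLE (e := 6 * a + 17) (by omega)
  obtain ⟨P₁, P₂, hdisj, hP₁, hP₂, hc₁, hc₂⟩ := exists_disjoint_primes hprimes
  obtain ⟨x, z, hx0, hx, hz0, hz, hcard⟩ := exists_many_sUnitSolutions ha1 hT hdisj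
    (fun p hp => (hP₁ p hp).1) (fun p hp => (hP₂ p hp).1) (fun p hp => (hP₁ p hp).2.2)
    (fun p hp => (hP₂ p hp).2.2) (fun p hp => (hP₂ p hp).2.1) hc₁ hc₂
  obtain ⟨S, hS⟩ : ∃ S, S = Nat.primesLE (T ^ (6 * a + 18)) ∪ (x.primeFactors ∪ z.primeFactors) :=
    ⟨_, rfl⟩
  rw [← hS] at hcard
  have hSle : #S ≤ T ^ (6 * a + 19) := by
    have h1 : #(Nat.primesLE (T ^ (6 * a + 18))) ≤ T ^ (6 * a + 18) := by
      rw [Nat.primesLE_eq_filter_Icc_one]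
      exact (card_filter_le _ _).trans (by simp)
    have h2 := card_primeFactors_le hx0 hx
    have h3 := card_primeFactors_le hz0 hz
    have h4 : #S ≤ T ^ (6 * a + 18) + (T * ((3 * a + 9) * T ^ a) + T * ((9 * a + 28) * T ^ a)) :=
      hS ▸ (card_union_le _ _).trans (add_le_add h1 ((card_union_le _ _).trans (add_le_add h2 h3)))
    have h5 : T * ((3 * a + 9) * T ^ a) + T * ((9 * a + 28) * T ^ a) ≤ T ^ (6 * a + 18) := by
      calc _ = (12 * a + 37) * T ^ (a + 1) := by ring
        _ ≤ T * T ^ (a + 1) := by gcongr; omega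
        _ = T ^ (a + 2) := by ring
        _ ≤ _ := Nat.pow_le_pow_right hT0 (by omega)
    calc #S ≤ 2 * T ^ (6 * a + 18) := by omega
      _ ≤ T * T ^ (6 * a + 18) := by gcongr; omega
      _ = _ := by ring
  have hSge : T ≤ #S := by
    calc T ≤ T ^ (6 * a + 17) := Nat.le_self_pow (by omega) T
      _ ≤ #(Nat.primesLE (T ^ (6 * a + 18))) := by omega
      _ ≤ _ := hS ▸ card_le_card subset_union_left
  refine ⟨S, ?_, by omega, ?_⟩
  · intro p hp
    rw [hS, mem_union, mem_union] at hp
    rcases hp with h | h | h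
    · exact Nat.prime_of_mem_primesLE h
    · exact Nat.prime_of_mem_primeFactors h
    · exact Nat.prime_of_mem_primeFactors h
  · have hexp : Real.exp ((#S : ℝ) ^ ((1 : ℝ) / 6 - ε)) ≤ ((T ^ T ^ a : ℕ) : ℝ) := by
      calc Real.exp ((#S : ℝ) ^ ((1 : ℝ) / 6 - ε)) ≤ Real.exp (((T ^ a : ℕ) : ℝ) * 1) := by
            rw [Real.exp_le_exp, mul_one]
            push_cast
            exact rpow_le_pow_of_le ha hε hT0 (hT0.trans_le hSge) hSle
        _ = Real.exp 1 ^ (T ^ a) := Real.exp_nat_mul _ _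
        _ ≤ (T : ℝ) ^ (T ^ a) := by
            gcongr
            have : (3 : ℝ) ≤ T := by exact_mod_cast (by omega : 3 ≤ T)
            exact Real.exp_one_lt_three.le.trans this
        _ = _ := by push_cast; rfl
    calc _ ≤ ENNReal.ofReal ((T ^ T ^ a : ℕ) : ℝ) := ENNReal.ofReal_le_ofReal hexp
      _ = (((T ^ T ^ a : ℕ) : ℕ∞) : ENNReal) := by
          rw [ENNReal.ofReal_natCast, ENat.toENNReal_coe]
      _ ≤ _ := ENat.toENNReal_mono hcard
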